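/- Let $d\ge 1$, let $\mathbb P^{N_d}$ be the projective space of non-zero forms $\sum_{|\alpha|=d}a_\alpha Z^\alpha$ of degree $d$ in $Z=(Z_0,Z_1,Z_2)$ over $\mathbb C$, and let $\mathcal X=\{\sum_{|\alpha|=d} a_\alpha Z^\alpha=0\}\subset\mathbb P^2\times\mathbb P^{N_d}$ be the universal curve of degree $d$. Let $\overline{J_2^v}(\mathbb P^2\times\mathbb P^{N_d})$ be the space of logarithmic $2$-jets of the log-manifold $(\mathbb P^2\times\mathbb P^{N_d},\mathcal X)$ that are tangent to the fibres of the projection to $\mathbb P^{N_d}$, with natural projection $p_2:\overline{J_2^v}(\mathbb P^2\times\mathbb P^{N_d})\to\mathbb P^2\times\mathbb P^{N_d}$. Let $U\subset\mathbb P^{N_d+1}$, with homogeneous coordinates $\big((a_\alpha)_{|\alpha|=d},a_{000d}\big)$, be the open set where $a_{000d}\neq0$ and $(a_\alpha)\ne 0$, let $\mathcal Y=\{a_{000d}Z_3^d+\sum_{|\alpha|=d}a_\alpha Z^\alpha=0\}\subset\mathbb P^3\times U$ and $H=\{Z_3=0\}\subset\mathcal Y$. Let $\overline{J_2^v}(\mathcal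 Y)$ be the space of logarithmic $2$-jets of $(\mathcal Y,H)$ tangent to the fibres of the projection to $U$, and let $\pi_2:\overline{J_2^v}(\mathcal Y)\to\overline{J_2^v}(\mathbb P^2\times\mathbb P^{N_d})$ be the map induced by the log-morphism $(\mathcal Y,H)\to(\mathbb P^2\times\mathbb P^{N_d},\mathcal X)$ forgetting $Z_3$ and $a_{000d}$. Let $\Sigma$ be the closure in $\overline{J_2^v}(\mathcal Y)$ of the set of jets over $\{Z_0\ne0\}$ with $\det(\xi_i^{(j)})_{1\le i,j\le2}=0$, where $\xi_i^{(j)}$ is the $j$-th derivative of the affine coordinate $z_i=Z_i/Z_0$ along the jet. Then there is an integer $m_0\ge 0$ such that for every $m\ge m_0$ the bundle $$T_{\overline{J_2^v}(\mathbb P^2\times\mathbb P^{N_d})}\otimes\mathcal O_{\mathbb P^2}(7)\otimes\mathcal O_{\mathbb P^{N_d}}(m)$$ is generated by its global holomorphic sections at every point of $\overline{J_2^v}(\mathbb P^2\times\mathbb P^{N_d})\setminus\big(\pi_2(\Sigma)\cup p_2^{-1}(\mathcal X)\big)$. (The line bundles are pulled back from $\mathbb P^2$ and $\mathbb P^{N_d}$.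 At singular points of $\overline{J_2^v}(\mathbb P^2\times\mathbb P^{N_d})$, all of which lie over $\mathcal X$, $T$ is the sheaf of holomorphic vector fields of the analytic space.) -/

import Mathlib

open MvPolynomial
open scoped LinearAlgebra.Projectivization Topology

namespace LogJet

noncomputable section

/-! ### Two-jets of curves in `ℂ^ι` and logarithmic two-jets -/

/-- The `2`-jet at `0` of a holomorphic curve `γ` in `ℂ^ι`: `J k i` is the `k`-th derivative at `0`
of the coordinate `γ i`, for `k = 0, 1, 2`. -/
abbrev Jet (ι : Type) : Type := Fin 3 → ι → ℂ

section Jets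

variable {ι : Type} [Fintype ι]

/-- `(f ∘ γ)'(0)` in terms of the `2`-jet `J` of `γ`. -/
def jetD1 (f : MvPolynomial ι ℂ) (J : Jet ι) : ℂ :=
  ∑ j, eval (J 0) (pderiv j f) * J 1 j

/-- `(f ∘ γ)''(0)` in terms of the `2`-jet `J` of `γ`. -/
def jetD2 (f : MvPolynomial ι ℂ) (J : Jet ι) : ℂ :=
  ∑ j, eval (J 0) (pderiv j f) * J 2 j +
    ∑ j, ∑ k, eval (J 0) (pderiv j (pderiv k f)) * J 1 j * J 1 k

/-- The pair `(J, σ)` is a logarithmic `2`-jet for the divisor `f = 0`: the numbers `σ 0`, `σ 1` are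
the values of the first and second derivative of `log f`, that is, of the coordinates attached to
the logarithmic form `df / f`. They are related to the ordinary jet by
`f' = f σ₀` and `f'' = f (σ₁ + σ₀²)`. Where `f` is part of a coordinate system, the ordinary jet
coordinates of `f` are determined by `f` and `σ`, so that these pairs are the points
`(ξ_f = σ, other jet coordinates)` of the usual trivialization of the logarithmic jet bundle. -/
def IsLogJet (f : MvPolynomial ι ℂ) (J : Jet ι) (σ : Fin 2 → ℂ) : Prop :=
  jetD1 f J = eval (J 0) f * σ 0 ∧ jetD2 f J = eval (J 0) f * (σ 1 + σ 0 ^ 2)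

/-- The jet `J` is tangent to the hypersurface `f = 0` (it belongs to its `2`-jet space). -/
def IsTangentTo (f : MvPolynomial ι ℂ) (J : Jet ι) : Prop :=
  eval (J 0) f = 0 ∧ jetD1 f J = 0 ∧ jetD2 f J = 0

end Jets

/-- The `2`-jet of the product `l · γ` of a scalar function `l` and a curve `γ`. -/
def scaleJet {ι : Type} (l : Fin 3 → ℂ) (J : Jet ι) : Jet ι :=
  ![l 0 • J 0, l 0 • J 1 + l 1 • J 0, l 0 • J 2 + (2 * l 1) • J 1 + l 2 • J 0]

/-- First and second derivative of `log l` in terms of the `2`-jet of the scalar function `l`. -/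
def logDer (l : Fin 3 → ℂ) : Fin 2 → ℂ :=
  ![l 1 / l 0, l 2 / l 0 - (l 1 / l 0) ^ 2]

/-- The `2`-jet of `1 / c` in terms of the `2`-jet of the scalar function `c`. -/
def invJet (c : Fin 3 → ℂ) : Fin 3 → ℂ :=
  ![(c 0)⁻¹, -c 1 / c 0 ^ 2, -c 2 / c 0 ^ 2 + 2 * c 1 ^ 2 / c 0 ^ 3]

/-! ### Plane curves of degree `d` and the universal curve -/

/-- The multi-indices `α ∈ ℕ³` with `|α| = d`; there are `N_d + 1` of them. -/
abbrev Idx (d : ℕ) : Type := ↥(Finset.finsuppAntidiag (Finset.univ : Finset (Fin 3)) d)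

/-- The form `∑_{|α| = d} a_α Z^α`. -/
def form {d : ℕ} (a : Idx d → ℂ) : MvPolynomial (Fin 3) ℂ :=
  ∑ α : Idx d, monomial α.1 (a α)

/-- The universal curve in `ℙ² × ℙ^{N_d}`. -/
def universalCurve (d : ℕ) : Set (ℙ ℂ (Fin 3 → ℂ) × ℙ ℂ (Idx d → ℂ)) :=
  {x | ∃ (Z : Fin 3 → ℂ) (hZ : Z ≠ 0) (a : Idx d → ℂ) (ha : a ≠ 0),
    eval Z (form a) = 0 ∧ x = (Projectivization.mk ℂ Z hZ, Projectivization.mk ℂ a ha)}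

/-! ### The space of vertical logarithmic `2`-jets of `(ℙ² × ℙ^{N_d}, universal curve)` -/

/-- Coordinates `(J, a, σ)`: the `2`-jet `J` of a curve `Z(t)` in `ℂ³`, a parameter `a` (constant
along the curve, since the jets are tangent to the fibres of the projection to `ℙ^{N_d}`), and
the logarithmic coordinates `σ` of the divisor `∑ a_α Z^α = 0`. -/
abbrev Coord (d : ℕ) : Type := Jet (Fin 3) × (Idx d → ℂ) × (Fin 2 → ℂ)

/-- The cone, in homogeneous coordinates, over the space of vertical logarithmic `2`-jets. -/
def cone (d : ℕ) : Set (Coord d) :=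
  {p | p.1 0 ≠ 0 ∧ p.2.1 ≠ 0 ∧ IsLogJet (form p.2.1) p.1 p.2.2}

/-- Change of homogeneous coordinates: `Z(t)` becomes `l(t) Z(t)`, `a` becomes `μ a`, and
`log ∑ a_α Z^α` becomes `log ∑ a_α Z^α + d log l + log μ`. -/
def act {d : ℕ} (l : Fin 3 → ℂ) (μ : ℂ) (p : Coord d) : Coord d :=
  (scaleJet l p.1, μ • p.2.1, p.2.2 + (d : ℂ) • logDer l)

/-- Two elements of the cone represent the same logarithmic jet. -/
def coneRel (d : ℕ) (p q : cone d) : Prop :=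
  ∃ (l : Fin 3 → ℂ) (μ : ℂ), l 0 ≠ 0 ∧ μ ≠ 0 ∧ q.1 = act l μ p.1

/-- The space of logarithmic `2`-jets of `(ℙ² × ℙ^{N_d}, universal curve)` tangent to the fibres
of the projection to `ℙ^{N_d}`, with the quotient topology. -/
abbrev JetSpace (d : ℕ) : Type := Quot (coneRel d)

/-- The natural projection `p₂` to `ℙ² × ℙ^{N_d}`. -/
def proj (d : ℕ) : JetSpace d → ℙ ℂ (Fin 3 → ℂ) × ℙ ℂ (Idx d → ℂ) :=
  Quot.lift
    (fun p => (Projectivization.mk ℂ (p.1.1 0) p.2.1, Projectivization.mk ℂ p.1.2.1 p.2.2.1))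
    (by
      rintro ⟨p, hp⟩ ⟨q, hq⟩ ⟨l, μ, hl, hμ, h⟩
      have h' : q = act l μ p := h
      subst h'
      refine Prod.ext ?_ ?_
      · exact (Projectivization.mk_eq_mk_iff' ℂ _ _ _ _).2 ⟨(l 0)⁻¹, by
          simp [act, scaleJet, smul_smul, hl]⟩
      · exact (Projectivization.mk_eq_mk_iff' ℂ _ _ _ _).2 ⟨μ⁻¹, by
          simp [act, smul_smul, hμ]⟩)

/-! ### The log-manifold `(𝒴, H)`, its vertical logarithmic `2`-jets and the set `Σ` -/

/-- Coordinates `(J, a, b, τ)`: the `2`-jet `J` of a curve `(Z₀, Z₁, Z₂, Z₃)(t)` in `ℂ⁴`, a parameter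
`(a, b)` with `b = a_{000d}`, and the logarithmic coordinates `τ` of the divisor `Z₃ = 0`. -/
abbrev CoordY (d : ℕ) : Type := Jet (Fin 4) × (Idx d → ℂ) × ℂ × (Fin 2 → ℂ)

/-- The form `b Z₃^d + ∑_{|α| = d} a_α Z^α` in four variables. -/
def formY {d : ℕ} (a : Idx d → ℂ) (b : ℂ) : MvPolynomial (Fin 4) ℂ :=
  C b * X (Fin.last 3) ^ d + rename Fin.castSucc (form a)

/-- The cone over the space of vertical logarithmic `2`-jets of `(𝒴, H)`, where `𝒴 ⊂ ℙ³ × U` is given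
by `b Z₃^d + ∑ a_α Z^α = 0`, `U ⊂ ℙ^{N_d + 1}` by `b ≠ 0` and `a ≠ 0`, and `H` by `Z₃ = 0`: it
consists of the vertical logarithmic jets of `(ℙ³ × U, {Z₃ = 0})` that are tangent to `𝒴`. -/
def coneY (d : ℕ) : Set (CoordY d) :=
  {p | p.1 0 ≠ 0 ∧ p.2.1 ≠ 0 ∧ p.2.2.1 ≠ 0 ∧ IsTangentTo (formY p.2.1 p.2.2.1) p.1 ∧
    IsLogJet (X (Fin.last 3)) p.1 p.2.2.2}

/-- Change of homogeneous coordinates; the form `Z₃` has degree one. -/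
def actY {d : ℕ} (l : Fin 3 → ℂ) (μ : ℂ) (p : CoordY d) : CoordY d :=
  (scaleJet l p.1, μ • p.2.1, μ * p.2.2.1, p.2.2.2 + logDer l)

/-- Two elements of the cone represent the same logarithmic jet of `(𝒴, H)`. -/
def coneRelY (d : ℕ) (p q : coneY d) : Prop :=
  ∃ (l : Fin 3 → ℂ) (μ : ℂ), l 0 ≠ 0 ∧ μ ≠ 0 ∧ q.1 = actY l μ p.1

/-- The space of vertical logarithmic `2`-jets of `(𝒴, H)`, with the quotient topology. -/
abbrev JetSpaceY (d : ℕ) : Type := Quot (coneRelY d)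

/-- The set `Σ₀`: over `Z₀ ≠ 0`, the determinant of `(ξ_i^{(j)})`, `1 ≤ i, j ≤ 2`, vanishes, where
`ξ_i^{(j)}` is the `j`-th derivative of the affine coordinate `z_i = Z_i / Z₀`. -/
def sigmaZero (d : ℕ) : Set (JetSpaceY d) :=
  {y | ∃ p : coneY d, Quot.mk _ p = y ∧ p.1.1 0 0 ≠ 0 ∧
    let ξ : Jet (Fin 4) := scaleJet (invJet fun k => p.1.1 k 0) p.1.1
    Matrix.det !![ξ 1 1, ξ 2 1; ξ 1 2, ξ 2 2] = 0}

/-- The set `Σ`, the closure of `Σ₀` in the space of vertical logarithmic `2`-jets of `(𝒴, H)`. -/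
def sigma (d : ℕ) : Set (JetSpaceY d) := closure (sigmaZero d)

/-- On homogeneous coordinates, the map induced by `𝒴 → ℙ² × ℙ^{N_d}`; since
`∑ a_α Z^α = -b Z₃^d` along the curve, the logarithmic coordinates are multiplied by `d`. -/
def piCoord {d : ℕ} (p : CoordY d) : Coord d :=
  (fun k j => p.1 k j.castSucc, p.2.1, (d : ℂ) • p.2.2.2)

section Auxiliary

variable {ι : Type} [Fintype ι]

lemma jetD1_add (f g : MvPolynomial ι ℂ) (J : Jet ι) :
    jetD1 (f + g) J = jetD1 f J + jetD1 g J := by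
  simp [jetD1, add_mul, Finset.sum_add_distrib]

lemma jetD2_add (f g : MvPolynomial ι ℂ) (J : Jet ι) :
    jetD2 (f + g) J = jetD2 f J + jetD2 g J := by
  simp only [jetD2, map_add, add_mul, Finset.sum_add_distrib]
  ring

lemma jetD1_mul (f g : MvPolynomial ι ℂ) (J : Jet ι) :
    jetD1 (f * g) J = jetD1 f J * eval (J 0) g + eval (J 0) f * jetD1 g J := by
  simp only [jetD1, Derivation.leibniz, smul_eq_mul, map_add, map_mul, Finset.sum_mul,
    Finset.mul_sum, ← Finset.sum_add_distrib]
  exact Finset.sum_congr rfl fun j _ => by ring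

lemma jetD2_mul (f g : MvPolynomial ι ℂ) (J : Jet ι) :
    jetD2 (f * g) J =
      jetD2 f J * eval (J 0) g + 2 * (jetD1 f J * jetD1 g J) + eval (J 0) f * jetD2 g J := by
  have e1 : jetD1 f J * jetD1 g J =
      ∑ j, ∑ k, (eval (J 0) (pderiv j f) * J 1 j) * (eval (J 0) (pderiv k g) * J 1 k) := by
    simp only [jetD1, Finset.sum_mul_sum]
  have e2 : jetD1 f J * jetD1 g J =
      ∑ j, ∑ k, (eval (J 0) (pderiv k f) * J 1 k) * (eval (J 0) (pderiv j g) * J 1 j) := by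
    rw [e1, Finset.sum_comm]
  rw [two_mul]
  nth_rewrite 1 [e1]
  rw [e2]
  simp only [jetD2, Derivation.leibniz, smul_eq_mul, map_add, map_mul, add_mul, mul_add,
    Finset.sum_mul, Finset.mul_sum, Finset.sum_add_distrib]
  simp only [mul_comm, mul_left_comm]
  ring

lemma jetD1_C (c : ℂ) (J : Jet ι) : jetD1 (C c) J = 0 := by simp [jetD1]

lemma jetD2_C (c : ℂ) (J : Jet ι) : jetD2 (C c) J = 0 := by simp [jetD2]

lemma isLogJet_pow {f : MvPolynomial ι ℂ} {J : Jet ι} {σ : Fin 2 → ℂ} (h : IsLogJet f J σ)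
    (n : ℕ) : IsLogJet (f ^ n) J ((n : ℂ) • σ) := by
  obtain ⟨h1, h2⟩ := h
  induction n with
  | zero =>
    rw [pow_zero]
    constructor
    · simp [jetD1]
    · simp [jetD2]
  | succ n ih =>
    obtain ⟨i1, i2⟩ := ih
    constructor
    · rw [pow_succ, jetD1_mul, i1, h1]
      simp only [map_mul, map_pow, Pi.smul_apply, smul_eq_mul]
      push_cast
      ring
    · rw [pow_succ, jetD2_mul, i1, i2, h1, h2]
      simp only [map_mul, map_pow, Pi.smul_apply, smul_eq_mul]
      push_cast
      ring

lemma jetD1_rename (f : MvPolynomial (Fin 3) ℂ) (J : Jet (Fin 4)) :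
    jetD1 (rename Fin.castSucc f) J = jetD1 f (fun k j => J k j.castSucc) := by
  induction f using MvPolynomial.induction_on with
  | C a => simp [jetD1_C]
  | add p q hp hq => simp only [map_add, jetD1_add, hp, hq]
  | mul_X p i hp =>
    have hX : jetD1 (X i.castSucc : MvPolynomial (Fin 4) ℂ) J =
        jetD1 (X i) (fun k j => J k j.castSucc) := by
      simp [jetD1, pderiv_X, Pi.single_apply, apply_ite]
    simp only [map_mul, rename_X, jetD1_mul, hp, hX, eval_rename, eval_X]
    rfl

lemma jetD2_rename (f : MvPolynomial (Fin 3) ℂ) (J : Jet (Fin 4)) :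
    jetD2 (rename Fin.castSucc f) J = jetD2 f (fun k j => J k j.castSucc) := by
  induction f using MvPolynomial.induction_on with
  | C a => simp [jetD2_C]
  | add p q hp hq => simp only [map_add, jetD2_add, hp, hq]
  | mul_X p i hp =>
    have hX : jetD2 (X i.castSucc : MvPolynomial (Fin 4) ℂ) J =
        jetD2 (X i) (fun k j => J k j.castSucc) := by
      simp [jetD2, pderiv_X, Pi.single_apply, apply_ite]
    have hX1 : jetD1 (X i.castSucc : MvPolynomial (Fin 4) ℂ) J =
        jetD1 (X i) (fun k j => J k j.castSucc) := by
      simpa using jetD1_rename (X i) J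
    simp only [map_mul, rename_X, jetD2_mul, hp, hX, hX1, jetD1_rename, eval_rename, eval_X]
    rfl

lemma eval_zero_form {d : ℕ} [NeZero d] (a : Idx d → ℂ) : eval 0 (form a) = 0 := by
  simp only [form, map_sum, eval_monomial]
  refine Finset.sum_eq_zero fun α _ => ?_
  have h := (Finset.mem_finsuppAntidiag.1 α.2).1
  have hne : ∃ i, α.1 i ≠ 0 := by
    by_contra! hc
    exact NeZero.ne d (by rw [← h]; simp [hc])
  obtain ⟨i, hi⟩ := hne
  rw [Finsupp.prod_fintype _ _ (by simp), Finset.prod_eq_zero (Finset.mem_univ i) (by simp [hi]),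
    mul_zero]

lemma piCoord_mem {d : ℕ} [NeZero d] {p : CoordY d} (hp : p ∈ coneY d) :
    piCoord p ∈ cone d := by
  obtain ⟨J, a, b, τ⟩ := p
  obtain ⟨hJ, ha, hb, ⟨h0, h1, h2⟩, hτ⟩ := hp
  obtain ⟨t1, t2⟩ := isLogJet_pow hτ d
  simp only [formY, jetD1_add, jetD2_add, jetD1_mul, jetD2_mul, jetD1_C, jetD2_C, map_add, map_mul,
    jetD1_rename, jetD2_rename, eval_rename, eval_C, zero_mul, mul_zero, zero_add] at h0 h1 h2
  rw [t1] at h1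
  rw [t2] at h2
  refine ⟨?_, ha, ?_, ?_⟩
  · intro hz
    have hz' : J 0 ∘ Fin.castSucc = 0 := hz
    rw [hz', eval_zero_form, add_zero] at h0
    have h3 : J 0 (Fin.last 3) = 0 := by
      rcases mul_eq_zero.1 h0 with h | h
      · exact absurd h hb
      · simpa [NeZero.ne d] using h
    apply hJ
    funext j
    refine Fin.lastCases h3 (fun i => ?_) j
    exact congrFun hz' i
  · change jetD1 (form a) (fun k j => J k j.castSucc) =
      eval (J 0 ∘ Fin.castSucc) (form a) * ((d : ℂ) • τ) 0
    linear_combination h1 - ((d : ℂ) • τ) 0 * h0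
  · change jetD2 (form a) (fun k j => J k j.castSucc) =
      eval (J 0 ∘ Fin.castSucc) (form a) * (((d : ℂ) • τ) 1 + ((d : ℂ) • τ) 0 ^ 2)
    linear_combination h2 - (((d : ℂ) • τ) 1 + ((d : ℂ) • τ) 0 ^ 2) * h0

end Auxiliary

/-- The map `π₂` induced on vertical logarithmic `2`-jets by the log-morphism
`(𝒴, H) → (ℙ² × ℙ^{N_d}, universal curve)`. -/
def piTwo (d : ℕ) [NeZero d] : JetSpaceY d → JetSpace d :=
  Quot.map (fun p => ⟨piCoord p.1, piCoord_mem p.2⟩) (by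
    rintro ⟨p, hp⟩ ⟨q, hq⟩ ⟨l, μ, hl, hμ, h⟩
    have h' : q = actY l μ p := h
    subst h'
    refine ⟨l, μ, hl, hμ, ?_⟩
    refine Prod.ext ?_ (Prod.ext ?_ ?_)
    · funext k j
      fin_cases k <;> simp [piCoord, actY, act, scaleJet]
    · rfl
    · simp [piCoord, actY, act])

/-! ### Charts, tangent spaces and global sections -/

/-- The chart `Z_i ≠ 0`, `a_β ≠ 0`, realized by the normalization `Z_i(t) = 1`, `a_β = 1`. -/
def chart (d : ℕ) (i : Fin 3) (β : Idx d) : Set (Coord d) :=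
  {p | p ∈ cone d ∧ p.1 0 i = 1 ∧ p.1 1 i = 0 ∧ p.1 2 i = 0 ∧ p.2.1 β = 1}

/-- The map to the chart `Z_i ≠ 0`, `a_β ≠ 0`: divide `Z(t)` by `Z_i(t)` and `a` by `a_β`. Between two
charts it is the change of coordinates. -/
def toChart {d : ℕ} (i : Fin 3) (β : Idx d) (p : Coord d) : Coord d :=
  act (invJet fun k => p.1 k i) (p.2.1 β)⁻¹ p

/-- The first equation of the cone, as a function of the coordinates. -/
def eqn1 {d : ℕ} (p : Coord d) : ℂ :=
  jetD1 (form p.2.1) p.1 - eval (p.1 0) (form p.2.1) * p.2.2 0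

/-- The second equation of the cone, as a function of the coordinates. -/
def eqn2 {d : ℕ} (p : Coord d) : ℂ :=
  jetD2 (form p.2.1) p.1 - eval (p.1 0) (form p.2.1) * (p.2.2 1 + p.2.2 0 ^ 2)

/-- The (Zariski) tangent space at `p` of the chart `Z_i = 1`, `a_β = 1`. -/
def tangent {d : ℕ} (i : Fin 3) (β : Idx d) (p : Coord d) : Set (Coord d) :=
  {w | (∀ k, w.1 k i = 0) ∧ w.2.1 β = 0 ∧ fderiv ℂ eqn1 p w = 0 ∧ fderiv ℂ eqn2 p w = 0}

/-- A map is holomorphic on the analytic subset `S`: near each point of `S` it is the restriction of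
a holomorphic map of the ambient space. -/
def HolomorphicOn {d : ℕ} (S : Set (Coord d)) (v : Coord d → Coord d) : Prop :=
  ∀ p ∈ S, ∃ u : Coord d → Coord d, AnalyticAt ℂ u p ∧ u =ᶠ[𝓝[S] p] v

/-- Global holomorphic sections of `T ⊗ O_{ℙ²}(k) ⊗ O_{ℙ^{N_d}}(m)`, with `T` the tangent bundle of the
space of vertical logarithmic `2`-jets: holomorphic vector fields on the charts, where the one on the
chart `(i, β)` is the section divided by `Z_i^k a_β^m`, glued by the transition functions of the
three factors. The value of `val i β` outside the chart is irrelevant. -/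
structure GlobalSection (d k m : ℕ) where
  val : Fin 3 → Idx d → Coord d → Coord d
  holomorphic : ∀ i β, HolomorphicOn (chart d i β) (val i β)
  mem_tangent : ∀ i β, ∀ p ∈ chart d i β, val i β p ∈ tangent i β p
  glue : ∀ i β j γ, ∀ p ∈ chart d i β, p.1 0 j ≠ 0 → p.2.1 γ ≠ 0 →
    val j γ (toChart j γ p) =
      (p.1 0 j ^ k * p.2.1 γ ^ m)⁻¹ • fderiv ℂ (toChart j γ) p (val i β p)

/-- `T ⊗ O_{ℙ²}(k) ⊗ O_{ℙ^{N_d}}(m)` is generated by its global sections at the point `x`: in every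
chart containing `x`, each vector of the fibre is the value of a global section. -/
def IsGeneratedAt (d k m : ℕ) (x : JetSpace d) : Prop :=
  ∀ (i : Fin 3) (β : Idx d) (p : cone d), Quot.mk _ p = x → p.1 ∈ chart d i β →
    ∀ w ∈ tangent i β p.1, ∃ s : GlobalSection d k m, s.val i β p.1 = w

end

end LogJet

/-!
Vector fields on the cone that are tangent to it and homogeneous under the changes of homogeneous
coordinates descend to global sections of the twisted tangent bundle. The linear vector fields of
`GL₃`, acting on jets and on forms simultaneously, have weight zero; at a jet that is neither
degenerate nor based on the curve, they span together with the directions of the orbits every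
direction of jets and of logarithmic coordinates. What is left are the variations of the form alone,
by forms vanishing along the jet. Those are values of homogeneous holomorphic families: modulo the
products of the tangent line with a line through the point and the osculating conics, every form is
a power of a fixed linear form times a linear form, and the latter vanishes along the jet only if it
is zero. The osculating conics have the largest weight, six.

A degenerate jet outside the curve lifts to `𝒴` by extracting a `d`-th root, and shearing the
coordinates makes it a limit of degenerate jets over `Z₀ ≠ 0`: it lies in `π₂(Σ)`.
-/

open scoped ContDiff Matrix

namespace LogJet

noncomputable section

/-! ### The algebra of 2-jets of scalar functions -/

/-- The product of `2`-jets of scalar functions of one variable; jets are given by their successive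
derivatives, so that binomial coefficients appear. -/
def jetMul : (Fin 3 → ℂ) →ₗ[ℂ] (Fin 3 → ℂ) →ₗ[ℂ] (Fin 3 → ℂ) :=
  LinearMap.mk₂ ℂ
    (fun u v => ![u 0 * v 0, u 0 * v 1 + u 1 * v 0, u 0 * v 2 + 2 * u 1 * v 1 + u 2 * v 0])
    (fun u u' v => by ext k; fin_cases k <;> simp <;> ring)
    (fun c u v => by ext k; fin_cases k <;> simp <;> ring)
    (fun u v v' => by ext k; fin_cases k <;> simp <;> ring)
    (fun c u v => by ext k; fin_cases k <;> simp <;> ring)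

lemma jetMul_apply (u v : Fin 3 → ℂ) : jetMul u v =
    ![u 0 * v 0, u 0 * v 1 + u 1 * v 0, u 0 * v 2 + 2 * u 1 * v 1 + u 2 * v 0] := rfl

lemma jetMul_apply_zero (u v : Fin 3 → ℂ) : jetMul u v 0 = u 0 * v 0 := rfl

lemma jetMul_comm (u v : Fin 3 → ℂ) : jetMul u v = jetMul v u := by
  ext k
  fin_cases k <;> simp [jetMul_apply] <;> ring

lemma jetMul_assoc (u v w : Fin 3 → ℂ) : jetMul (jetMul u v) w = jetMul u (jetMul v w) := by
  ext k
  fin_cases k <;> simp [jetMul_apply] <;> ring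

lemma jetMul_right_comm (u v w : Fin 3 → ℂ) :
    jetMul (jetMul u v) w = jetMul (jetMul u w) v := by
  rw [jetMul_assoc, jetMul_comm v, jetMul_assoc]

lemma jetMul_left_comm (u v w : Fin 3 → ℂ) :
    jetMul u (jetMul v w) = jetMul v (jetMul u w) := by
  rw [← jetMul_assoc, jetMul_comm u, jetMul_assoc]

lemma jetMul_single (c : ℂ) (u : Fin 3 → ℂ) : jetMul u (Pi.single 0 c) = c • u := by
  ext k
  fin_cases k <;> simp [jetMul_apply, mul_comm]

lemma single_jetMul (c : ℂ) (u : Fin 3 → ℂ) : jetMul (Pi.single 0 c) u = c • u := by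
  rw [jetMul_comm, jetMul_single]

lemma jetMul_invJet {u : Fin 3 → ℂ} (hu : u 0 ≠ 0) : jetMul (invJet u) u = Pi.single 0 1 := by
  ext k
  fin_cases k <;> simp [jetMul_apply, invJet, hu] <;> field_simp <;> ring

lemma invJet_single (c : ℂ) : invJet (Pi.single 0 c) = Pi.single 0 c⁻¹ := by
  ext k
  fin_cases k <;> simp [invJet]

lemma logDer_single (c : ℂ) : logDer (Pi.single 0 c) = 0 := by
  ext k
  fin_cases k <;> simp [logDer]

lemma logDer_jetMul {u v : Fin 3 → ℂ} (hu : u 0 ≠ 0) (hv : v 0 ≠ 0) :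
    logDer (jetMul u v) = logDer u + logDer v := by
  ext k
  fin_cases k <;> simp [jetMul_apply, logDer] <;> field_simp <;> ring

lemma contDiff_bilinear_apply {E F G H : Type*} [NormedAddCommGroup E] [NormedSpace ℂ E]
    [NormedAddCommGroup F] [NormedSpace ℂ F] [FiniteDimensional ℂ F] [NormedAddCommGroup G]
    [NormedSpace ℂ G] [FiniteDimensional ℂ G] [NormedAddCommGroup H] [NormedSpace ℂ H]
    (B : F →ₗ[ℂ] G →ₗ[ℂ] H) {n : WithTop ℕ∞} {f : E → F} {g : E → G} (hf : ContDiff ℂ n f)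
    (hg : ContDiff ℂ n g) : ContDiff ℂ n fun x => B (f x) (g x) :=
  B.toContinuousBilinearMap.isBoundedBilinearMap.contDiff.comp (hf.prodMk hg)

lemma hasDerivAt_jetMul {u v : ℂ → Fin 3 → ℂ} {u' v' : Fin 3 → ℂ} {s : ℂ}
    (hu : HasDerivAt u u' s) (hv : HasDerivAt v v' s) :
    HasDerivAt (fun t => jetMul (u t) (v t)) (jetMul u' (v s) + jetMul (u s) v') s := by
  simpa [add_comm] using jetMul.toContinuousBilinearMap.hasDerivAt_of_bilinear
    (fun _ => hu) (fun _ => hv)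

section ScaleJet

variable {ι : Type}

lemma scaleJet_coord (l : Fin 3 → ℂ) (J : Jet ι) (j : ι) :
    (fun k => scaleJet l J k j) = jetMul l fun k => J k j := by
  ext k
  fin_cases k <;> simp [scaleJet, jetMul_apply]

lemma jet_ext {J K : Jet ι} (h : ∀ j, (fun k => J k j) = fun k => K k j) : J = K :=
  funext fun k => funext fun j => congrFun (h j) k

lemma scaleJet_zero_apply (l : Fin 3 → ℂ) (J : Jet ι) : scaleJet l J 0 = l 0 • J 0 := rfl

lemma scaleJet_scaleJet (l m : Fin 3 → ℂ) (J : Jet ι) :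
    scaleJet l (scaleJet m J) = scaleJet (jetMul l m) J :=
  jet_ext fun j => by simp only [scaleJet_coord, jetMul_assoc]

lemma scaleJet_add (l : Fin 3 → ℂ) (J K : Jet ι) :
    scaleJet l (J + K) = scaleJet l J + scaleJet l K :=
  jet_ext fun j => (scaleJet_coord l (J + K) j).trans <|
    (map_add (jetMul l) (fun k => J k j) fun k => K k j).trans <|
      congrArg₂ (· + ·) (scaleJet_coord l J j).symm (scaleJet_coord l K j).symm

lemma add_scaleJet (l m : Fin 3 → ℂ) (J : Jet ι) :
    scaleJet (l + m) J = scaleJet l J + scaleJet m J := by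
  ext k j
  fin_cases k <;> simp [scaleJet] <;> ring

lemma scaleJet_smul (l : Fin 3 → ℂ) (c : ℂ) (J : Jet ι) :
    scaleJet l (c • J) = c • scaleJet l J := by
  ext k j
  fin_cases k <;> simp [scaleJet] <;> ring

lemma smul_scaleJet (c : ℂ) (l : Fin 3 → ℂ) (J : Jet ι) :
    scaleJet (c • l) J = c • scaleJet l J := by
  ext k j
  fin_cases k <;> simp [scaleJet] <;> ring

lemma single_scaleJet (c : ℂ) (J : Jet ι) : scaleJet (Pi.single 0 c) J = c • J := by
  ext k j
  fin_cases k <;> simp [scaleJet]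

end ScaleJet

/-! ### The jet of a polynomial along a curve, and its variation -/

section EvalJet

variable {ι : Type} [Fintype ι]

/-- The `2`-jet of the scalar function `f ∘ γ`, in terms of the `2`-jet `J` of `γ`. -/
def evalJet (J : Jet ι) : MvPolynomial ι ℂ →ₗ[ℂ] (Fin 3 → ℂ) where
  toFun f := ![eval (J 0) f, jetD1 f J, jetD2 f J]
  map_add' f g := by
    ext k
    fin_cases k <;> simp [jetD1_add, jetD2_add]
  map_smul' c f := by
    ext k
    fin_cases k <;> simp [smul_eq_C_mul, jetD1_mul, jetD2_mul, jetD1_C, jetD2_C]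

lemma evalJet_apply (J : Jet ι) (f : MvPolynomial ι ℂ) :
    evalJet J f = ![eval (J 0) f, jetD1 f J, jetD2 f J] := rfl

lemma evalJet_apply_zero (J : Jet ι) (f : MvPolynomial ι ℂ) : evalJet J f 0 = eval (J 0) f := rfl

lemma evalJet_mul (J : Jet ι) (f g : MvPolynomial ι ℂ) :
    evalJet J (f * g) = jetMul (evalJet J f) (evalJet J g) := by
  ext k
  fin_cases k <;> simp [evalJet_apply, jetMul_apply, jetD1_mul, jetD2_mul] <;> ring

lemma evalJet_C (J : Jet ι) (c : ℂ) : evalJet J (C c) = Pi.single 0 c := by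
  ext k
  fin_cases k <;> simp [evalJet_apply, jetD1_C, jetD2_C]

lemma evalJet_C_mul (J : Jet ι) (c : ℂ) (f : MvPolynomial ι ℂ) :
    evalJet J (C c * f) = c • evalJet J f := by
  rw [← smul_eq_C_mul, map_smul]

lemma evalJet_X (J : Jet ι) (i : ι) : evalJet J (X i) = fun k => J k i := by
  classical
  ext k
  fin_cases k <;> simp [evalJet_apply, jetD1, jetD2, pderiv_X, Pi.single_apply, apply_ite]

lemma evalJet_eq_zero_iff {J : Jet ι} {f : MvPolynomial ι ℂ} :
    evalJet J f = 0 ↔ IsTangentTo f J := by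
  simp [evalJet_apply, IsTangentTo]

/-- The variation of `evalJet J f` when the jet `J` moves in the direction `K`. -/
def jetVar (f : MvPolynomial ι ℂ) (J K : Jet ι) : Fin 3 → ℂ :=
  ∑ j, jetMul (evalJet J (pderiv j f)) fun k => K k j

lemma jetVar_C (c : ℂ) (J K : Jet ι) : jetVar (C c) J K = 0 := by
  simp [jetVar]

lemma jetVar_X (i : ι) (J K : Jet ι) : jetVar (X i) J K = fun k => K k i := by
  classical
  rw [jetVar, Finset.sum_eq_single i]
  · rw [pderiv_X_self, ← C_1, evalJet_C, single_jetMul, one_smul]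
  · intro j _ hj
    rw [pderiv_X_of_ne hj.symm, map_zero, LinearMap.map_zero₂]
  · exact fun h => absurd (Finset.mem_univ i) h

lemma jetVar_zero (f : MvPolynomial ι ℂ) (J : Jet ι) : jetVar f J 0 = 0 :=
  Finset.sum_eq_zero fun j _ => map_zero (jetMul (evalJet J (pderiv j f)))

lemma jetVar_add (f g : MvPolynomial ι ℂ) (J K : Jet ι) :
    jetVar (f + g) J K = jetVar f J K + jetVar g J K := by
  simp [jetVar, Finset.sum_add_distrib]

lemma jetVar_mul (f g : MvPolynomial ι ℂ) (J K : Jet ι) : jetVar (f * g) J K =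
    jetMul (jetVar f J K) (evalJet J g) + jetMul (evalJet J f) (jetVar g J K) := by
  simp only [jetVar, Derivation.leibniz, smul_eq_mul, map_add, evalJet_mul, LinearMap.add_apply,
    Finset.sum_add_distrib, map_sum, LinearMap.sum_apply]
  rw [add_comm]
  refine congrArg₂ (· + ·) (Finset.sum_congr rfl fun j _ => ?_)
    (Finset.sum_congr rfl fun j _ => jetMul_assoc _ _ _)
  rw [jetMul_comm (evalJet J g), jetMul_right_comm]

lemma hasDerivAt_evalJet (f : MvPolynomial ι ℂ) (J K : Jet ι) :
    HasDerivAt (fun s : ℂ => evalJet (J + s • K) f) (jetVar f J K) 0 := by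
  induction f using MvPolynomial.induction_on with
  | C c => simpa only [evalJet_C, jetVar_C] using hasDerivAt_const 0 _
  | add f g hf hg => simpa only [map_add, jetVar_add] using hf.fun_add hg
  | mul_X f i hf =>
    have hX : HasDerivAt (fun s : ℂ => fun k => (J + s • K) k i) (fun k => K k i) 0 :=
      hasDerivAt_pi.2 fun k => by
        simpa using ((hasDerivAt_id (0 : ℂ)).mul_const (K k i)).const_add (J k i)
    simpa only [evalJet_mul, evalJet_X, jetVar_mul, jetVar_X, zero_smul, add_zero] using
      hasDerivAt_jetMul hf hX

lemma contDiff_evalJet (f : MvPolynomial ι ℂ) : ContDiff ℂ ω fun J : Jet ι => evalJet J f := by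
  induction f using MvPolynomial.induction_on with
  | C c => simpa only [evalJet_C] using contDiff_const
  | add f g hf hg => simpa only [map_add] using hf.add hg
  | mul_X f i hf =>
    simp only [evalJet_mul, evalJet_X]
    exact contDiff_bilinear_apply jetMul hf (by fun_prop)

lemma jetVar_scaleJet {f : MvPolynomial ι ℂ} {d : ℕ} (hf : f.IsHomogeneous d) (l : Fin 3 → ℂ)
    (J : Jet ι) : jetVar f J (scaleJet l J) = (d : ℂ) • jetMul l (evalJet J f) := by
  calc jetVar f J (scaleJet l J)
      = jetMul l (evalJet J (∑ j, X j * pderiv j f)) := by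
        simp only [jetVar, scaleJet_coord, map_sum, evalJet_mul, evalJet_X]
        exact Finset.sum_congr rfl fun j _ => by rw [jetMul_left_comm, jetMul_comm (evalJet J _)]
    _ = (d : ℂ) • jetMul l (evalJet J f) := by
        rw [hf.sum_X_mul_pderiv, map_nsmul, map_nsmul, Nat.cast_smul_eq_nsmul]

/-! ### Linear forms and linear vector fields -/

/-- The linear form with coefficients `v`. -/
def linearForm : (ι → ℂ) →ₗ[ℂ] MvPolynomial ι ℂ :=
  Fintype.linearCombination ℂ X

lemma linearForm_apply (v : ι → ℂ) : linearForm v = ∑ i, C (v i) * X i := by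
  simp [linearForm, Fintype.linearCombination_apply, smul_eq_C_mul]

lemma linearForm_isHomogeneous (v : ι → ℂ) : (linearForm v).IsHomogeneous 1 := by
  rw [linearForm_apply]
  exact IsHomogeneous.sum _ _ _ fun i _ => by
    simpa using (isHomogeneous_C ι (v i)).mul (isHomogeneous_X ℂ i)

lemma evalJet_linearForm (J : Jet ι) (v : ι → ℂ) :
    evalJet J (linearForm v) = fun k => v ⬝ᵥ J k := by
  ext k
  simp [linearForm_apply, evalJet_C_mul, evalJet_X, dotProduct, Finset.sum_apply]

/-- The derivative of polynomials along the linear vector field `x ↦ A x`. -/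
def linearDeriv (A : Matrix ι ι ℂ) : MvPolynomial ι ℂ →ₗ[ℂ] MvPolynomial ι ℂ :=
  ∑ i, LinearMap.mulLeft ℂ (linearForm (A i)) ∘ₗ (pderiv i).toLinearMap

lemma linearDeriv_apply (A : Matrix ι ι ℂ) (f : MvPolynomial ι ℂ) :
    linearDeriv A f = ∑ i, linearForm (A i) * pderiv i f := by
  simp [linearDeriv]

lemma evalJet_linearDeriv (A : Matrix ι ι ℂ) (f : MvPolynomial ι ℂ) (J : Jet ι) :
    evalJet J (linearDeriv A f) = jetVar f J fun k => A.mulVec (J k) := by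
  simp only [linearDeriv_apply, map_sum, evalJet_mul, evalJet_linearForm, jetVar]
  exact Finset.sum_congr rfl fun j _ => jetMul_comm _ _

lemma linearDeriv_isHomogeneous (A : Matrix ι ι ℂ) {f : MvPolynomial ι ℂ} {d : ℕ}
    (hd : d ≠ 0) (hf : f.IsHomogeneous d) : (linearDeriv A f).IsHomogeneous d := by
  rw [linearDeriv_apply]
  refine IsHomogeneous.sum _ _ _ fun i _ => ?_
  simpa [Nat.add_sub_cancel' (Nat.one_le_iff_ne_zero.2 hd)] using
    (linearForm_isHomogeneous (A i)).mul (hf.pderiv (i := i))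

end EvalJet

/-! ### Forms and the equations of the cone -/

lemma form_add {d : ℕ} (a b : Idx d → ℂ) : form (a + b) = form a + form b := by
  simp [form, Finset.sum_add_distrib]

lemma form_smul {d : ℕ} (c : ℂ) (a : Idx d → ℂ) : form (c • a) = c • form a := by
  simp [form, Finset.smul_sum, smul_monomial]

lemma mem_idx_iff {d : ℕ} {s : Fin 3 →₀ ℕ} :
    s ∈ Finset.finsuppAntidiag Finset.univ d ↔ s.degree = d := by
  simp [Finset.mem_finsuppAntidiag, Finsupp.degree_eq_sum]

lemma form_isHomogeneous {d : ℕ} (a : Idx d → ℂ) : (form a).IsHomogeneous d :=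
  IsHomogeneous.sum _ _ _ fun α _ => isHomogeneous_monomial _ (mem_idx_iff.1 α.2)

/-- The coefficients of the monomials of degree `d`. -/
def coeffs (d : ℕ) : MvPolynomial (Fin 3) ℂ →ₗ[ℂ] (Idx d → ℂ) :=
  LinearMap.pi fun α => lcoeff ℂ α.1

lemma coeffs_apply {d : ℕ} (f : MvPolynomial (Fin 3) ℂ) (α : Idx d) :
    coeffs d f α = coeff α.1 f := rfl

lemma coeffs_form {d : ℕ} (a : Idx d → ℂ) : coeffs d (form a) = a := by
  classical
  ext α
  simp [coeffs_apply, form, coeff_sum, coeff_monomial, Subtype.ext_iff.symm]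

lemma form_coeffs {d : ℕ} {f : MvPolynomial (Fin 3) ℂ} (hf : f.IsHomogeneous d) :
    form (coeffs d f) = f := by
  classical
  ext s
  by_cases hs : s.degree = d
  · exact congrFun (coeffs_form (coeffs d f)) ⟨s, mem_idx_iff.2 hs⟩
  · rw [(form_isHomogeneous _).coeff_eq_zero hs, hf.coeff_eq_zero hs]

/-- The `2`-jet of the exponential of a curve, up to the factor given by its value, in terms of the
first and second derivative of the curve. -/
def expJet (σ : Fin 2 → ℂ) : Fin 3 → ℂ := ![1, σ 0, σ 1 + σ 0 ^ 2]

/-- The derivative of `expJet` at `σ` in the direction `τ`. -/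
def expVar (σ τ : Fin 2 → ℂ) : Fin 3 → ℂ := ![0, τ 0, τ 1 + 2 * σ 0 * τ 0]

lemma expVar_zero (σ : Fin 2 → ℂ) : expVar σ 0 = 0 := by
  ext k
  fin_cases k <;> simp [expVar]

lemma hasDerivAt_expJet (σ τ : Fin 2 → ℂ) :
    HasDerivAt (fun s : ℂ => expJet (σ + s • τ)) (expVar σ τ) 0 := by
  have h (k : Fin 2) : HasDerivAt (fun s : ℂ => (σ + s • τ) k) (τ k) 0 := by
    simpa using ((hasDerivAt_id (0 : ℂ)).mul_const (τ k)).const_add (σ k)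
  refine hasDerivAt_pi.2 fun k => ?_
  fin_cases k
  · exact hasDerivAt_const _ _
  · exact h 0
  · simpa [expVar, expJet] using (h 1).fun_add ((h 0).fun_pow 2)

lemma isLogJet_iff {ι : Type} [Fintype ι] {f : MvPolynomial ι ℂ} {J : Jet ι} {σ : Fin 2 → ℂ} :
    IsLogJet f J σ ↔ evalJet J f = eval (J 0) f • expJet σ := by
  simp [IsLogJet, evalJet_apply, expJet]

section Cone

variable {d : ℕ}

/-- The `2`-jet of the form `∑ a_α Z^α` along the jet `J`, at the point `(J, a, σ)`. -/
def formJet (p : Coord d) : Fin 3 → ℂ := evalJet p.1 (form p.2.1)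

/-- The derivative of `formJet` at `p` in the direction `w`. -/
def formVar (p w : Coord d) : Fin 3 → ℂ :=
  jetVar (form p.2.1) p.1 w.1 + evalJet p.1 (form w.2.1)

lemma mem_cone_iff {p : Coord d} : p ∈ cone d ↔
    p.1 0 ≠ 0 ∧ p.2.1 ≠ 0 ∧ formJet p = formJet p 0 • expJet p.2.2 := by
  simp [cone, isLogJet_iff, formJet, evalJet_apply_zero]

lemma contDiff_formJet : ContDiff ℂ ω (formJet (d := d)) := by
  have h (p : Coord d) : formJet p = ∑ α, p.2.1 α • evalJet p.1 (monomial α.1 1) := by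
    simp only [formJet, form, map_sum]
    exact Finset.sum_congr rfl fun α _ => by
      rw [← mul_one (p.2.1 α), ← C_mul_monomial, evalJet_C_mul, mul_one]
  simp only [funext h]
  exact ContDiff.sum fun α _ => ContDiff.smul (f := fun p : Coord d => p.2.1 α) (by fun_prop)
    ((contDiff_evalJet _).comp contDiff_fst)

lemma hasDerivAt_formJet (p w : Coord d) :
    HasDerivAt (fun s : ℂ => formJet (p + s • w)) (formVar p w) 0 := by
  have h := (hasDerivAt_evalJet (form p.2.1) p.1 w.1).fun_add
    ((hasDerivAt_id (0 : ℂ)).fun_smul (hasDerivAt_evalJet (form w.2.1) p.1 w.1))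
  simpa [formVar, formJet, form_add, form_smul] using h

lemma hasDerivAt_coneEquations (p w : Coord d) :
    HasDerivAt (fun s : ℂ => formJet (p + s • w) - formJet (p + s • w) 0 • expJet (p + s • w).2.2)
      (formVar p w - (formVar p w 0 • expJet p.2.2 + formJet p 0 • expVar p.2.2 w.2.2)) 0 := by
  have h := hasDerivAt_formJet p w
  have h0 := (hasDerivAt_pi.1 h 0).fun_smul (hasDerivAt_expJet p.2.2 w.2.2)
  simpa [add_comm] using h.fun_sub h0

lemma eqn1_eq (p : Coord d) : eqn1 p = (formJet p - formJet p 0 • expJet p.2.2) 1 := by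
  simp [eqn1, formJet, evalJet_apply, expJet]

lemma eqn2_eq (p : Coord d) : eqn2 p = (formJet p - formJet p 0 • expJet p.2.2) 2 := by
  simp [eqn2, formJet, evalJet_apply, expJet]

lemma contDiff_expJet : ContDiff ℂ ω expJet := by
  refine contDiff_pi.2 fun k => ?_
  fin_cases k
  · exact contDiff_const
  · exact contDiff_apply ℂ ℂ 0
  · exact (contDiff_apply ℂ ℂ 1).add ((contDiff_apply ℂ ℂ 0).pow 2)

lemma differentiable_coneEquations :
    Differentiable ℂ fun p : Coord d => formJet p - formJet p 0 • expJet p.2.2 := by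
  have h := contDiff_formJet (d := d)
  have he : ContDiff ℂ ω fun p : Coord d => expJet p.2.2 := contDiff_expJet.comp (by fun_prop)
  exact (h.sub ((contDiff_pi.1 h 0).smul he)).differentiable (by simp)

lemma differentiable_eqn1 : Differentiable ℂ (eqn1 (d := d)) := by
  simpa only [← eqn1_eq] using differentiable_pi.1 differentiable_coneEquations 1

lemma differentiable_eqn2 : Differentiable ℂ (eqn2 (d := d)) := by
  simpa only [← eqn2_eq] using differentiable_pi.1 differentiable_coneEquations 2

/-- The kernel of the differentials of the two equations of the cone: the tangent directions to the
cone at `p`, including those along the orbits of the rescalings. -/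
def coneTangent (p : Coord d) : Submodule ℂ (Coord d) :=
  (fderiv ℂ eqn1 p).ker ⊓ (fderiv ℂ eqn2 p).ker

lemma fderiv_eqn1 (p w : Coord d) : fderiv ℂ eqn1 p w =
    formVar p w 1 - (formVar p w 0 * p.2.2 0 + formJet p 0 * w.2.2 0) := by
  rw [← (differentiable_eqn1 p).lineDeriv_eq_fderiv, lineDeriv]
  simp only [eqn1_eq]
  exact (hasDerivAt_pi.1 (hasDerivAt_coneEquations p w) 1).deriv

lemma fderiv_eqn2 (p w : Coord d) : fderiv ℂ eqn2 p w =
    formVar p w 2 - (formVar p w 0 * (p.2.2 1 + p.2.2 0 ^ 2) +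
      formJet p 0 * (w.2.2 1 + 2 * p.2.2 0 * w.2.2 0)) := by
  rw [← (differentiable_eqn2 p).lineDeriv_eq_fderiv, lineDeriv]
  simp only [eqn2_eq]
  exact (hasDerivAt_pi.1 (hasDerivAt_coneEquations p w) 2).deriv

lemma mem_coneTangent_iff {p w : Coord d} : w ∈ coneTangent p ↔
    formVar p w = formVar p w 0 • expJet p.2.2 + formJet p 0 • expVar p.2.2 w.2.2 := by
  simp [coneTangent, fderiv_eqn1, fderiv_eqn2, funext_iff, Fin.forall_fin_succ, expJet, expVar,
    sub_eq_zero]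

lemma mem_coneTangent_of_formVar_eq_zero {p w : Coord d} (hw : formVar p w = 0) (hσ : w.2.2 = 0) :
    w ∈ coneTangent p := by
  simp [mem_coneTangent_iff, hw, hσ, expVar_zero]

lemma formVar_add (p v w : Coord d) : formVar p (v + w) = formVar p v + formVar p w := by
  have h : jetVar (form p.2.1) p.1 (v + w).1 =
      jetVar (form p.2.1) p.1 v.1 + jetVar (form p.2.1) p.1 w.1 := by
    rw [jetVar, jetVar, jetVar, ← Finset.sum_add_distrib]
    exact Finset.sum_congr rfl fun j _ => map_add _ (fun k => v.1 k j) fun k => w.1 k j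
  rw [formVar, h, Prod.snd_add, Prod.fst_add, form_add, map_add, formVar, formVar]
  exact add_add_add_comm _ _ _ _

/-! ### The orbits of the changes of homogeneous coordinates -/

/-- The linear part of the change of homogeneous coordinates `act l μ`. -/
def actLin (l : Fin 3 → ℂ) (μ : ℂ) : Coord d →ₗ[ℂ] Coord d where
  toFun w := (scaleJet l w.1, μ • w.2.1, w.2.2)
  map_add' _ _ := Prod.ext (scaleJet_add _ _ _) (Prod.ext (smul_add _ _ _) rfl)
  map_smul' _ _ := Prod.ext (scaleJet_smul _ _ _) (Prod.ext (smul_comm _ _ _) rfl)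

lemma actLin_apply (l : Fin 3 → ℂ) (μ : ℂ) (w : Coord d) :
    actLin l μ w = (scaleJet l w.1, μ • w.2.1, w.2.2) := rfl

lemma act_eq_actLin_add (l : Fin 3 → ℂ) (μ : ℂ) (p : Coord d) :
    act l μ p = actLin l μ p + (0, 0, (d : ℂ) • logDer l) := by
  simp [act, actLin_apply]

lemma act_act {l m : Fin 3 → ℂ} (hl : l 0 ≠ 0) (hm : m 0 ≠ 0) (μ ν : ℂ) (p : Coord d) :
    act l μ (act m ν p) = act (jetMul l m) (μ * ν) p := by
  simp only [act, scaleJet_scaleJet, smul_smul, logDer_jetMul hl hm, smul_add, add_assoc,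
    add_comm ((d : ℂ) • logDer l)]

lemma act_one (p : Coord d) : act (Pi.single 0 1) 1 p = p := by
  simp [act, single_scaleJet, logDer_single]

lemma hasFDerivAt_act (l : Fin 3 → ℂ) (μ : ℂ) (p : Coord d) :
    HasFDerivAt (act l μ) (actLin l μ).toContinuousLinearMap p := by
  simp only [funext (act_eq_actLin_add l μ)]
  exact (actLin l μ).toContinuousLinearMap.hasFDerivAt.add_const _

/-- The velocity at `p` of the change of coordinates `act l μ` when `(l, μ)` leaves the identity
in the direction `(m, ν)`. -/
def orbitMap (p : Coord d) : ((Fin 3 → ℂ) × ℂ) →ₗ[ℂ] Coord d where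
  toFun x := (scaleJet x.1 p.1, x.2 • p.2.1, (d : ℂ) • ![x.1 1, x.1 2])
  map_add' x y := Prod.ext (add_scaleJet _ _ _) (Prod.ext (add_smul _ _ _) (by
    ext k; fin_cases k <;> simp <;> ring))
  map_smul' c x := Prod.ext (smul_scaleJet _ _ _) (Prod.ext (smul_assoc _ _ _) (by
    ext k; fin_cases k <;> simp <;> ring))

lemma orbitMap_apply (p : Coord d) (x : (Fin 3 → ℂ) × ℂ) :
    orbitMap p x = (scaleJet x.1 p.1, x.2 • p.2.1, (d : ℂ) • ![x.1 1, x.1 2]) := rfl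

lemma hasDerivAt_logDer (m : Fin 3 → ℂ) :
    HasDerivAt (fun s : ℂ => logDer (Pi.single 0 1 + s • m)) ![m 1, m 2] 0 := by
  have h (k : Fin 3) : HasDerivAt (fun s : ℂ => (Pi.single 0 1 + s • m : Fin 3 → ℂ) k) (m k) 0 := by
    simpa using ((hasDerivAt_id (0 : ℂ)).mul_const (m k)).const_add
      ((Pi.single 0 1 : Fin 3 → ℂ) k)
  have h1 := (h 1).fun_div (h 0) (by simp)
  have h2 := ((h 2).fun_div (h 0) (by simp)).fun_sub (h1.fun_pow 2)
  refine hasDerivAt_pi.2 fun k => ?_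
  fin_cases k
  · simpa [logDer] using h1
  · simpa [logDer] using h2

lemma hasDerivAt_act_one (p : Coord d) (x : (Fin 3 → ℂ) × ℂ) :
    HasDerivAt (fun s : ℂ => act (Pi.single 0 1 + s • x.1) (1 + s * x.2) p) (orbitMap p x) 0 := by
  have h (s : ℂ) : act (Pi.single 0 1 + s • x.1) (1 + s * x.2) p = p +
      (s • scaleJet x.1 p.1, (s * x.2) • p.2.1, (d : ℂ) • logDer (Pi.single 0 1 + s • x.1)) := by
    simp only [act, add_scaleJet, single_scaleJet, smul_scaleJet, add_smul, one_smul]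
    rfl
  simp only [h]
  have hid := hasDerivAt_id (0 : ℂ)
  refine HasDerivAt.const_add p (.prodMk ?_ (.prodMk ?_ ((hasDerivAt_logDer x.1).fun_const_smul _)))
  · simpa using hid.smul_const (scaleJet x.1 p.1)
  · simpa using (hid.mul_const x.2).smul_const p.2.1

lemma formVar_orbitMap (p : Coord d) (x : (Fin 3 → ℂ) × ℂ) :
    formVar p (orbitMap p x) = (d : ℂ) • jetMul x.1 (formJet p) + x.2 • formJet p := by
  simp [formVar, orbitMap_apply, jetVar_scaleJet (form_isHomogeneous _), form_smul, formJet]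

lemma orbitMap_mem_coneTangent {p : Coord d} (hp : p ∈ cone d) (x : (Fin 3 → ℂ) × ℂ) :
    orbitMap p x ∈ coneTangent p := by
  have h := (mem_cone_iff.1 hp).2.2
  rw [mem_coneTangent_iff, formVar_orbitMap, orbitMap_apply, h]
  ext k
  fin_cases k <;> simp [jetMul_apply, expJet, expVar] <;> ring

end Cone

/-! ### Charts -/

lemma contDiff_scaleJet {ι : Type} [Fintype ι] :
    ContDiff ℂ ω fun x : (Fin 3 → ℂ) × Jet ι => scaleJet x.1 x.2 := by
  refine contDiff_pi.2 fun k => contDiff_pi.2 fun j => ?_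
  have hJ : ContDiff ℂ ω fun x : (Fin 3 → ℂ) × Jet ι => fun k => x.2 k j := by fun_prop
  simpa only [← scaleJet_coord] using
    contDiff_pi.1 (contDiff_bilinear_apply jetMul contDiff_fst hJ) k

lemma contDiffAt_invJet {u : Fin 3 → ℂ} (hu : u 0 ≠ 0) : ContDiffAt ℂ ω invJet u := by
  have h2 := pow_ne_zero 2 hu
  have h3 := pow_ne_zero 3 hu
  refine contDiffAt_pi.2 fun k => ?_
  fin_cases k
  · change ContDiffAt ℂ ω (fun u : Fin 3 → ℂ => (u 0)⁻¹) u
    fun_prop (disch := assumption)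
  · change ContDiffAt ℂ ω (fun u : Fin 3 → ℂ => -u 1 / u 0 ^ 2) u
    fun_prop (disch := assumption)
  · change ContDiffAt ℂ ω
      (fun u : Fin 3 → ℂ => -u 2 / u 0 ^ 2 + 2 * u 1 ^ 2 / u 0 ^ 3) u
    fun_prop (disch := assumption)

lemma contDiffAt_logDer {u : Fin 3 → ℂ} (hu : u 0 ≠ 0) : ContDiffAt ℂ ω logDer u := by
  refine contDiffAt_pi.2 fun k => ?_
  fin_cases k
  · change ContDiffAt ℂ ω (fun u : Fin 3 → ℂ => u 1 / u 0) u
    fun_prop (disch := assumption)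
  · change ContDiffAt ℂ ω (fun u : Fin 3 → ℂ => u 2 / u 0 - (u 1 / u 0) ^ 2) u
    fun_prop (disch := assumption)

lemma invJet_jetMul {u v : Fin 3 → ℂ} (hu : u 0 ≠ 0) :
    jetMul (invJet (jetMul u v)) u = invJet v := by
  ext k
  fin_cases k <;> simp [jetMul_apply, invJet] <;> field_simp <;> ring

section Charts

variable {d : ℕ} {i : Fin 3} {β : Idx d}

/-- The jet of the coordinate `Z_i` and the value of the coordinate `a_β`, which the chart `(i, β)`
normalizes to be the constant jet `1` and `1`. -/
def normCoord (i : Fin 3) (β : Idx d) : Coord d →ₗ[ℂ] ((Fin 3 → ℂ) × ℂ) where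
  toFun p := (fun k => p.1 k i, p.2.1 β)
  map_add' _ _ := rfl
  map_smul' _ _ := rfl

lemma normCoord_apply (i : Fin 3) (β : Idx d) (p : Coord d) :
    normCoord i β p = (fun k => p.1 k i, p.2.1 β) := rfl

lemma mem_chart_iff {p : Coord d} :
    p ∈ chart d i β ↔ p ∈ cone d ∧ normCoord i β p = (Pi.single 0 1, 1) := by
  refine and_congr_right fun _ => ?_
  simp [normCoord_apply, funext_iff, Fin.forall_fin_succ, and_assoc]

lemma mem_tangent_iff {p w : Coord d} :
    w ∈ tangent i β p ↔ normCoord i β w = 0 ∧ w ∈ coneTangent p := by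
  simp [tangent, normCoord_apply, coneTangent, Prod.ext_iff, funext_iff, and_assoc]

lemma normCoord_act (l : Fin 3 → ℂ) (μ : ℂ) (p : Coord d) : normCoord i β (act l μ p) =
    (jetMul l (normCoord i β p).1, μ * (normCoord i β p).2) :=
  Prod.ext (scaleJet_coord l p.1 i) rfl

lemma normCoord_orbitMap {p : Coord d} (hp : normCoord i β p = (Pi.single 0 1, 1))
    (x : (Fin 3 → ℂ) × ℂ) : normCoord i β (orbitMap p x) = x := by
  have h : normCoord i β (orbitMap p x) =
      (jetMul x.1 (normCoord i β p).1, x.2 * (normCoord i β p).2) :=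
    Prod.ext (scaleJet_coord x.1 p.1 i) rfl
  rw [h, hp, jetMul_single, one_smul, mul_one]

lemma toChart_eq (p : Coord d) : toChart i β p =
    act (invJet (normCoord i β p).1) (normCoord i β p).2⁻¹ p := rfl

lemma normCoord_toChart {p : Coord d} (hi : p.1 0 i ≠ 0) (hβ : p.2.1 β ≠ 0) :
    normCoord i β (toChart i β p) = (Pi.single 0 1, 1) := by
  rw [toChart_eq, normCoord_act, jetMul_invJet hi]
  exact Prod.ext rfl (inv_mul_cancel₀ hβ)

lemma toChart_of_normCoord_eq_one {p : Coord d} (hp : normCoord i β p = (Pi.single 0 1, 1)) :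
    toChart i β p = p := by
  rw [toChart_eq, hp, invJet_single, inv_one, act_one]

lemma toChart_act {p : Coord d} (hi : p.1 0 i ≠ 0) {l : Fin 3 → ℂ} {μ : ℂ} (hl : l 0 ≠ 0)
    (hμ : μ ≠ 0) : toChart i β (act l μ p) = toChart i β p := by
  have h0 : invJet (jetMul l (normCoord i β p).1) 0 ≠ 0 := inv_ne_zero (mul_ne_zero hl hi)
  rw [toChart_eq, normCoord_act, act_act h0 hl, invJet_jetMul hl, mul_inv_rev,
    inv_mul_cancel_right₀ hμ, toChart_eq]

lemma contDiffAt_toChart {p : Coord d} (hi : p.1 0 i ≠ 0) (hβ : p.2.1 β ≠ 0) :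
    ContDiffAt ℂ ω (toChart i β) p := by
  have hc : ContDiff ℂ ω fun p : Coord d => fun k => p.1 k i := by fun_prop
  have hl : ContDiffAt ℂ ω (fun p : Coord d => invJet fun k => p.1 k i) p :=
    (contDiffAt_invJet hi).comp p hc.contDiffAt
  have hσ : ContDiffAt ℂ ω (fun p : Coord d => logDer (invJet fun k => p.1 k i)) p :=
    (contDiffAt_logDer (inv_ne_zero hi)).comp p hl
  have hJ : ContDiffAt ℂ ω (fun p : Coord d => scaleJet (invJet fun k => p.1 k i) p.1) p :=
    contDiff_scaleJet.contDiffAt.comp p (hl.prodMk contDiffAt_fst)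
  have hβ' : ContDiffAt ℂ ω (fun p : Coord d => p.2.1 β) p := by fun_prop
  have ha : ContDiffAt ℂ ω (fun p : Coord d => (p.2.1 β)⁻¹ • p.2.1) p :=
    (hβ'.inv hβ).smul (by fun_prop)
  have hd : ContDiffAt ℂ ω (fun p : Coord d => p.2.2) p := by fun_prop
  exact hJ.prodMk (ha.prodMk (hd.add (hσ.const_smul (d : ℂ))))

lemma differentiableAt_toChart {p : Coord d} (hi : p.1 0 i ≠ 0) (hβ : p.2.1 β ≠ 0) :
    DifferentiableAt ℂ (toChart i β) p :=
  (contDiffAt_toChart hi hβ).differentiableAt (by simp)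

lemma fderiv_toChart_act {p : Coord d} (hi : p.1 0 i ≠ 0) (hβ : p.2.1 β ≠ 0) {l : Fin 3 → ℂ}
    {μ : ℂ} (hl : l 0 ≠ 0) (hμ : μ ≠ 0) (w : Coord d) :
    fderiv ℂ (toChart i β) p w = fderiv ℂ (toChart i β) (act l μ p) (actLin l μ w) := by
  have hq : DifferentiableAt ℂ (toChart i β) (act l μ p) :=
    differentiableAt_toChart (mul_ne_zero hl hi) (mul_ne_zero hμ hβ)
  have hcont : Continuous fun q : Coord d => q.1 0 i := by fun_prop
  have h : toChart i β ∘ act l μ =ᶠ[𝓝 p] toChart i β :=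
    (hcont.continuousAt.eventually_ne hi).mono fun q hq => toChart_act hq hl hμ
  rw [((hq.hasFDerivAt.comp p (hasFDerivAt_act l μ p)).congr_of_eventuallyEq h.symm).fderiv]
  rfl

lemma fderiv_toChart_orbitMap {p : Coord d} (hi : p.1 0 i ≠ 0) (hβ : p.2.1 β ≠ 0)
    (x : (Fin 3 → ℂ) × ℂ) : fderiv ℂ (toChart i β) p (orbitMap p x) = 0 := by
  set γ : ℂ → Coord d := fun s => act (Pi.single 0 1 + s • x.1) (1 + s * x.2) p
  have hγ0 : γ 0 = p := by simp [γ, act_one]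
  have hγ : HasDerivAt (toChart i β ∘ γ) (fderiv ℂ (toChart i β) p (orbitMap p x)) 0 :=
    HasFDerivAt.comp_hasDerivAt 0 (hγ0 ▸ (differentiableAt_toChart hi hβ).hasFDerivAt)
      (hasDerivAt_act_one p x)
  have hl : ∀ᶠ s : ℂ in 𝓝 0, (Pi.single 0 1 + s • x.1 : Fin 3 → ℂ) 0 ≠ 0 :=
    ContinuousAt.eventually_ne (by fun_prop) (by simp)
  have hμ : ∀ᶠ s : ℂ in 𝓝 0, 1 + s * x.2 ≠ 0 :=
    ContinuousAt.eventually_ne (by fun_prop) (by simp)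
  refine hγ.unique ((hasDerivAt_const 0 (toChart i β p)).congr_of_eventuallyEq ?_)
  filter_upwards [hl, hμ] with s hls hμs using toChart_act hi hls hμs

lemma fderiv_toChart_of_normCoord_eq_zero {p w : Coord d}
    (hp : normCoord i β p = (Pi.single 0 1, 1)) (hw : normCoord i β w = 0)
    (hd : DifferentiableAt ℂ (toChart i β) p) : fderiv ℂ (toChart i β) p w = w := by
  have h (s : ℂ) : toChart i β (p + s • w) = p + s • w :=
    toChart_of_normCoord_eq_one (by simp [hp, hw])
  rw [← hd.lineDeriv_eq_fderiv, lineDeriv]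
  simp only [h]
  simpa using (((hasDerivAt_id (0 : ℂ)).smul_const w).const_add p).deriv

lemma fderiv_toChart {p : Coord d} (hp : normCoord i β p = (Pi.single 0 1, 1)) (w : Coord d) :
    fderiv ℂ (toChart i β) p w = w - orbitMap p (normCoord i β w) := by
  have hi : p.1 0 i ≠ 0 := by
    have h : p.1 0 i = 1 := congrArg (fun x => x.1 0) hp
    exact h ▸ one_ne_zero
  have hβ : p.2.1 β ≠ 0 := by
    have h : p.2.1 β = 1 := congrArg Prod.snd hp
    exact h ▸ one_ne_zero
  have hw : normCoord i β (w - orbitMap p (normCoord i β w)) = 0 := by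
    rw [map_sub, normCoord_orbitMap hp, sub_self]
  rw [← fderiv_toChart_of_normCoord_eq_zero hp hw (differentiableAt_toChart hi hβ), map_sub,
    fderiv_toChart_orbitMap hi hβ, sub_zero]

/-! ### Homogeneous vector fields on the cone and global sections -/

/-- Holomorphic vector fields of weight `(k, m)` tangent to the cone: modulo the orbits, they are
the global sections of the tangent bundle twisted by `O(k)` and `O(m)`. -/
def homogeneousFields (d k m : ℕ) : Submodule ℂ (Coord d → Coord d) where
  carrier := {V | ContDiff ℂ ω V ∧ (∀ p ∈ cone d, V p ∈ coneTangent p) ∧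
    ∀ l μ p, V (act l μ p) = (l 0 ^ k * μ ^ m) • actLin l μ (V p)}
  add_mem' := by
    rintro V W ⟨hV, hVt, hVs⟩ ⟨hW, hWt, hWs⟩
    exact ⟨hV.add hW, fun p hp => add_mem (hVt p hp) (hWt p hp), fun l μ p => by
      simp only [Pi.add_apply, hVs, hWs, map_add, smul_add]⟩
  zero_mem' := ⟨contDiff_const, fun p _ => zero_mem (coneTangent p), fun l μ p => by simp⟩
  smul_mem' := by
    rintro c V ⟨hV, hVt, hVs⟩
    exact ⟨hV.const_smul c, fun p hp => (coneTangent p).smul_mem c (hVt p hp), fun l μ p => by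
      simp only [Pi.smul_apply, hVs, map_smul, smul_comm c]⟩

lemma monomial_smul_mem_homogeneousFields {k m : ℕ} {V : Coord d → Coord d}
    (hV : V ∈ homogeneousFields d k m) (i : Fin 3) (β : Idx d) (k' m' : ℕ) :
    (fun p => (p.1 0 i ^ k' * p.2.1 β ^ m') • V p) ∈ homogeneousFields d (k' + k) (m' + m) := by
  obtain ⟨hV, hVt, hVs⟩ := hV
  have hs : ContDiff ℂ ω fun p : Coord d => p.1 0 i ^ k' * p.2.1 β ^ m' := by fun_prop
  refine ⟨hs.smul hV, fun p hp => (coneTangent p).smul_mem _ (hVt p hp),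
    fun l μ p => ?_⟩
  have hi : (act l μ p).1 0 i = l 0 * p.1 0 i := rfl
  have ha : (act l μ p).2.1 β = μ * p.2.1 β := rfl
  simp only [hi, ha, hVs, map_smul, smul_smul]
  ring_nf

lemma contDiff_orbitMap : ContDiff ℂ ω fun x : Coord d × ((Fin 3 → ℂ) × ℂ) =>
    orbitMap x.1 x.2 := by
  simp only [orbitMap_apply]
  refine ContDiff.prodMk ?_ (ContDiff.prodMk (by fun_prop) ?_)
  · exact contDiff_scaleJet.comp (by fun_prop : ContDiff ℂ ω fun x : Coord d × ((Fin 3 → ℂ) × ℂ) =>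
      (x.2.1, x.1.1))
  · refine contDiff_pi.2 fun k => ?_
    fin_cases k
    · exact contDiff_const.mul (by fun_prop : ContDiff ℂ ω fun x : Coord d × ((Fin 3 → ℂ) × ℂ) =>
        x.2.1 1)
    · exact contDiff_const.mul (by fun_prop : ContDiff ℂ ω fun x : Coord d × ((Fin 3 → ℂ) × ℂ) =>
        x.2.1 2)

/-- The global section defined by a homogeneous vector field on the cone: in each chart, project the
field along the orbits. -/
def GlobalSection.ofField {k m : ℕ} {V : Coord d → Coord d} (hV : V ∈ homogeneousFields d k m) :
    GlobalSection d k m where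
  val i β p := V p - orbitMap p (normCoord i β (V p))
  holomorphic i β p _ := by
    have hN : ContDiff ℂ ω fun p => normCoord i β (V p) :=
      (normCoord i β).toContinuousLinearMap.contDiff.comp hV.1
    have h := hV.1.sub (contDiff_orbitMap.comp (contDiff_id.prodMk hN))
    exact ⟨_, h.contDiffAt.analyticAt, Filter.EventuallyEq.rfl⟩
  mem_tangent i β p hp := by
    obtain ⟨hc, hn⟩ := mem_chart_iff.1 hp
    exact mem_tangent_iff.2 ⟨by rw [map_sub, normCoord_orbitMap hn, sub_self],
      sub_mem (hV.2.1 p hc) (orbitMap_mem_coneTangent hc _)⟩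
  glue i β j γ p _ hj hγ := by
    have hl : (invJet fun r => p.1 r j) 0 ≠ 0 := inv_ne_zero hj
    have hμ : (p.2.1 γ)⁻¹ ≠ 0 := inv_ne_zero hγ
    have hq : act (invJet fun r => p.1 r j) (p.2.1 γ)⁻¹ p = toChart j γ p := rfl
    have hVq : V (toChart j γ p) = (p.1 0 j ^ k * p.2.1 γ ^ m)⁻¹ •
        actLin (invJet fun r => p.1 r j) (p.2.1 γ)⁻¹ (V p) := by
      rw [← hq, hV.2.2]
      simp [invJet, mul_comm]
    have hn := normCoord_toChart hj hγ
    rw [map_sub, fderiv_toChart_orbitMap hj hγ, sub_zero, fderiv_toChart_act hj hγ hl hμ, hq,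
      fderiv_toChart hn, hVq]
    simp only [map_smul, smul_sub]

lemma GlobalSection.ofField_val {k m : ℕ} {V : Coord d → Coord d}
    (hV : V ∈ homogeneousFields d k m) {p : Coord d} (hp : p ∈ chart d i β) {w : Coord d}
    (hw : w ∈ tangent i β p) {x : (Fin 3 → ℂ) × ℂ} (h : V p = w + orbitMap p x) :
    (GlobalSection.ofField hV).val i β p = w := by
  have hx : normCoord i β (V p) = x := by
    rw [h, map_add, (mem_tangent_iff.1 hw).1, normCoord_orbitMap (mem_chart_iff.1 hp).2, zero_add]
  exact (congrArg (V p - orbitMap p ·) hx).trans (sub_eq_of_eq_add h)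

end Charts

/-! ### Fields induced by linear vector fields -/

section Fields

variable {d : ℕ}

/-- The field induced on the cone by the linear vector field `x ↦ A x` of `ℂ³`; the form moves in
such a way that the jet of its values does not change. -/
def linearField (d : ℕ) (A : Matrix (Fin 3) (Fin 3) ℂ) : Coord d →ₗ[ℂ] Coord d where
  toFun p := (fun k => A.mulVec (p.1 k), coeffs d (-linearDeriv A (form p.2.1)), 0)
  map_add' p q := by
    refine Prod.ext (funext fun k => A.mulVec_add (p.1 k) (q.1 k)) (Prod.ext ?_ (add_zero 0).symm)
    simp [form_add, add_comm]
  map_smul' c p := by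
    refine Prod.ext (funext fun k => A.mulVec_smul c (p.1 k)) (Prod.ext ?_ (smul_zero c).symm)
    simp [form_smul]

lemma linearField_apply (A : Matrix (Fin 3) (Fin 3) ℂ) (p : Coord d) : linearField d A p =
    (fun k => A.mulVec (p.1 k), coeffs d (-linearDeriv A (form p.2.1)), 0) := rfl

lemma formVar_linearField (hd : d ≠ 0) (A : Matrix (Fin 3) (Fin 3) ℂ) (p : Coord d) :
    formVar p (linearField d A p) = 0 := by
  have h := form_coeffs (linearDeriv_isHomogeneous A hd (form_isHomogeneous p.2.1)).neg
  rw [formVar, linearField_apply, h, map_neg (evalJet p.1), evalJet_linearDeriv, add_neg_cancel]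

lemma mulVec_scaleJet (A : Matrix (Fin 3) (Fin 3) ℂ) (l : Fin 3 → ℂ) (J : Jet (Fin 3)) :
    (fun k => A.mulVec (scaleJet l J k)) = scaleJet l fun k => A.mulVec (J k) := by
  ext k j
  fin_cases k <;> simp [scaleJet, Matrix.mulVec_add, Matrix.mulVec_smul]

lemma linearField_mem_homogeneousFields (hd : d ≠ 0) (A : Matrix (Fin 3) (Fin 3) ℂ) :
    ⇑(linearField d A) ∈ homogeneousFields d 0 0 := by
  refine ⟨(linearField d A).toContinuousLinearMap.contDiff, fun p _ =>
    mem_coneTangent_of_formVar_eq_zero (formVar_linearField hd A p) rfl, fun l μ p => ?_⟩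
  rw [pow_zero, pow_zero, mul_one, one_smul, actLin_apply]
  refine Prod.ext (mulVec_scaleJet A l p.1) (Prod.ext ?_ rfl)
  simp [linearField_apply, act, form_smul]

end Fields

/-! ### Families of forms -/

section Families

variable {ι : Type} {d e k m : ℕ}

/-- Holomorphic families of forms of degree `d` parametrized by jets, of weight `k` under rescaling
of the jet. -/
def formFamilies (ι : Type) [Fintype ι] (d k : ℕ) : Submodule ℂ (Jet ι → MvPolynomial ι ℂ) where
  carrier := {P | (∀ s, ContDiff ℂ ω fun J => coeff s (P J)) ∧ (∀ J, (P J).IsHomogeneous d) ∧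
    ∀ l J, P (scaleJet l J) = l 0 ^ k • P J}
  add_mem' := by
    rintro P Q ⟨hP, hPd, hPk⟩ ⟨hQ, hQd, hQk⟩
    refine ⟨fun s => ?_, fun J => (hPd J).add (hQd J), fun l J => ?_⟩
    · simpa only [Pi.add_apply, coeff_add] using (hP s).add (hQ s)
    · simp only [Pi.add_apply, hPk, hQk, smul_add]
  zero_mem' := ⟨fun s => by simpa using contDiff_const, fun _ => isHomogeneous_zero _ _ _,
    fun _ _ => by simp⟩
  smul_mem' := by
    rintro c P ⟨hP, hPd, hPk⟩
    refine ⟨fun s => ?_, fun J => ?_, fun l J => ?_⟩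
    · simpa only [Pi.smul_apply, coeff_smul] using (hP s).const_smul c
    · exact Submodule.smul_mem (homogeneousSubmodule ι ℂ d) c (hPd J)
    · simp only [Pi.smul_apply, hPk, smul_comm c]

variable [Fintype ι]

lemma mul_mem_formFamilies {P Q : Jet ι → MvPolynomial ι ℂ} (hP : P ∈ formFamilies ι d k)
    (hQ : Q ∈ formFamilies ι e m) :
    (fun J => P J * Q J) ∈ formFamilies ι (d + e) (k + m) := by
  classical
  refine ⟨fun s => ?_, fun J => (hP.2.1 J).mul (hQ.2.1 J), fun l J => ?_⟩
  · simp only [coeff_mul]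
    exact ContDiff.sum fun x _ => (hP.1 x.1).mul (hQ.1 x.2)
  · simp only [hP.2.2, hQ.2.2, smul_mul_smul_comm, pow_add]

lemma const_mem_formFamilies {F : MvPolynomial ι ℂ} (hF : F.IsHomogeneous d) :
    (fun _ => F) ∈ formFamilies ι d 0 :=
  ⟨fun _ => contDiff_const, fun _ => hF, fun _ _ => by simp⟩

lemma scalar_mem_formFamilies {c : Jet ι → ℂ} (hc : ContDiff ℂ ω c)
    (hk : ∀ l J, c (scaleJet l J) = l 0 ^ k * c J) :
    (fun J => C (c J)) ∈ formFamilies ι 0 k := by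
  classical
  refine ⟨fun s => ?_, fun J => isHomogeneous_C _ _, fun l J => ?_⟩
  · simp only [coeff_C]
    split_ifs
    exacts [hc, contDiff_const]
  · simp only [hk, C_mul, smul_eq_C_mul]

lemma linearForm_mem_formFamilies {v : Jet ι → ι → ℂ} (hv : ContDiff ℂ ω v)
    (hk : ∀ l J, v (scaleJet l J) = l 0 ^ k • v J) :
    (fun J => linearForm (v J)) ∈ formFamilies ι 1 k := by
  refine ⟨fun s => ?_, fun J => linearForm_isHomogeneous _, fun l J => by simp only [hk, map_smul]⟩
  exact (lcoeff ℂ s ∘ₗ linearForm).toContinuousLinearMap.contDiff.comp hv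

/-- The families whose member attached to a jet vanishes along this jet. -/
def tangentForms (ι : Type) [Fintype ι] (d k : ℕ) : Submodule ℂ (Jet ι → MvPolynomial ι ℂ) where
  carrier := {P | P ∈ formFamilies ι d k ∧ ∀ J, evalJet J (P J) = 0}
  add_mem' hP hQ := ⟨add_mem hP.1 hQ.1, fun J => by
    rw [Pi.add_apply, map_add, hP.2, hQ.2, add_zero]⟩
  zero_mem' := ⟨zero_mem _, fun J => map_zero _⟩
  smul_mem' c P hP := ⟨Submodule.smul_mem _ c hP.1, fun J => by
    rw [Pi.smul_apply, map_smul, hP.2, smul_zero]⟩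

/-- The forms which are the member attached to the jet `J` of a family in `tangentForms`. -/
def tangentFormsAt (d k : ℕ) (J : Jet ι) : Submodule ℂ (MvPolynomial ι ℂ) :=
  (tangentForms ι d k).map (LinearMap.proj J)

lemma evalJet_of_mem_tangentFormsAt {J : Jet ι} {F : MvPolynomial ι ℂ}
    (hF : F ∈ tangentFormsAt d k J) : evalJet J F = 0 := by
  obtain ⟨P, hP, rfl⟩ := hF
  exact hP.2 J

lemma mul_mem_tangentForms {P Q : Jet ι → MvPolynomial ι ℂ} (hP : P ∈ tangentForms ι d k)
    (hQ : Q ∈ formFamilies ι e m) : (fun J => P J * Q J) ∈ tangentForms ι (d + e) (k + m) :=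
  ⟨mul_mem_formFamilies hP.1 hQ, fun J => by rw [evalJet_mul, hP.2, map_zero, LinearMap.zero_apply]⟩

lemma mul_mem_tangentFormsAt {J : Jet ι} {F G : MvPolynomial ι ℂ} (hF : F ∈ tangentFormsAt d k J)
    (hG : G.IsHomogeneous e) : F * G ∈ tangentFormsAt (d + e) k J := by
  obtain ⟨P, hP, rfl⟩ := hF
  exact Submodule.mem_map_of_mem (f := LinearMap.proj J)
    (mul_mem_tangentForms hP (const_mem_formFamilies hG))

lemma tangentFormsAt_mono {J : Jet ι} {i : ι} (hi : J 0 i ≠ 0) (hk : k ≤ m) :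
    tangentFormsAt d k J ≤ tangentFormsAt d m J := by
  obtain ⟨n, rfl⟩ := Nat.exists_eq_add_of_le hk
  rintro _ ⟨P, hP, rfl⟩
  have hc : ContDiff ℂ ω fun K : Jet ι => K 0 i ^ n := by fun_prop
  have hQ := mul_mem_tangentForms hP <|
    scalar_mem_formFamilies hc fun l K => mul_pow (l 0) (K 0 i) n
  have h := Submodule.mem_map_of_mem (f := LinearMap.proj J) hQ
  have hJ : P J = (J 0 i ^ n)⁻¹ • (P J * C (J 0 i ^ n)) := by
    rw [mul_comm, ← smul_eq_C_mul, inv_smul_smul₀ (pow_ne_zero n hi)]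
  exact (congrArg (· ∈ _) hJ).mpr (Submodule.smul_mem _ _ h)

end Families

/-- The vector field on the cone which moves only the form, along a family of forms. The factor
`a_β` makes it homogeneous in `a`. -/
def formField {d : ℕ} (β : Idx d) (P : Jet (Fin 3) → MvPolynomial (Fin 3) ℂ) (p : Coord d) :
    Coord d :=
  (0, p.2.1 β • coeffs d (P p.1), 0)

lemma formField_mem_homogeneousFields {d k : ℕ} (β : Idx d)
    {P : Jet (Fin 3) → MvPolynomial (Fin 3) ℂ} (hP : P ∈ tangentForms (Fin 3) d k) :
    formField β P ∈ homogeneousFields d k 0 := by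
  obtain ⟨⟨hPc, hPd, hPk⟩, hP0⟩ := hP
  have hc : ContDiff ℂ ω fun p : Coord d => coeffs d (P p.1) :=
    contDiff_pi.2 fun α => (hPc α.1).comp contDiff_fst
  have hβ : ContDiff ℂ ω fun p : Coord d => p.2.1 β := by fun_prop
  refine ⟨contDiff_const.prodMk ((hβ.smul hc).prodMk contDiff_const), fun p _ =>
    mem_coneTangent_of_formVar_eq_zero ?_ rfl, fun l μ p => ?_⟩
  · rw [formVar, formField, form_smul, form_coeffs (hPd _), map_smul, hP0, smul_zero, add_zero,
      jetVar_zero]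
  · have hPl : P (act l μ p).1 = l 0 ^ k • P p.1 := hPk l p.1
    have hβμ : (act l μ p).2.1 β = μ * p.2.1 β := rfl
    simp only [formField, hPl, hβμ, actLin_apply, map_smul, pow_zero, mul_one]
    refine Prod.ext ?_ (Prod.ext ?_ (smul_zero _).symm)
    · ext k j
      fin_cases k <;> simp [scaleJet]
    · simp only [Prod.smul_mk, smul_smul]
      ring_nf

/-! ### Tangent lines and osculating conics -/

section Plane

/-- The determinant of a `2`-jet in `ℂ³`, nonzero if and only if its image in `ℙ²` is immersed and
has no inflection. -/
def wronskian (J : Jet (Fin 3)) : ℂ := Matrix.det (Matrix.of J)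

lemma wronskian_scaleJet (l : Fin 3 → ℂ) (J : Jet (Fin 3)) :
    wronskian (scaleJet l J) = l 0 ^ 3 * wronskian J := by
  simp [wronskian, Matrix.det_fin_three, scaleJet]
  ring

lemma contDiff_wronskian : ContDiff ℂ ω wronskian := by
  have h (J : Jet (Fin 3)) : wronskian J = _ := Matrix.det_fin_three (Matrix.of J)
  simp only [funext h, Matrix.of_apply]
  fun_prop

/-- The basis of linear forms dual to `J 0, J 1, J 2`, multiplied by the determinant. The last one
is the tangent line. -/
def dualFrame (J : Jet (Fin 3)) : Fin 3 → Fin 3 → ℂ := ![J 1 ⨯₃ J 2, J 2 ⨯₃ J 0, J 0 ⨯₃ J 1]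

lemma dualFrame_dotProduct (J : Jet (Fin 3)) (k r : Fin 3) :
    dualFrame J k ⬝ᵥ J r = (Pi.single k (wronskian J) : Fin 3 → ℂ) r := by
  fin_cases k <;> fin_cases r <;>
    simp [dualFrame, cross_apply, wronskian, Matrix.det_fin_three, dotProduct,
      Fin.sum_univ_three] <;> ring

lemma wronskian_smul_eq_sum_dualFrame (J : Jet (Fin 3)) (v : Fin 3 → ℂ) :
    wronskian J • v = ∑ k, (v ⬝ᵥ J k) • dualFrame J k := by
  ext r
  fin_cases r <;>
    simp [dualFrame, cross_apply, wronskian, Matrix.det_fin_three, dotProduct,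
      Fin.sum_univ_three] <;> ring

lemma evalJet_dualFrame (J : Jet (Fin 3)) (k : Fin 3) :
    evalJet J (linearForm (dualFrame J k)) = Pi.single k (wronskian J) := by
  rw [evalJet_linearForm]
  exact funext (dualFrame_dotProduct J k)

lemma tangentLine_mem_formFamilies :
    (fun J => linearForm (J 0 ⨯₃ J 1)) ∈ formFamilies (Fin 3) 1 2 := by
  refine linearForm_mem_formFamilies (contDiff_bilinear_apply crossProduct
    (contDiff_apply ℂ _ 0) (contDiff_apply ℂ _ 1)) fun l J => ?_
  simp [scaleJet, cross_self, smul_smul, sq]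

lemma secantLine_mem_formFamilies (w : Fin 3 → ℂ) :
    (fun J => linearForm (J 0 ⨯₃ w)) ∈ formFamilies (Fin 3) 1 1 :=
  linearForm_mem_formFamilies
    (contDiff_bilinear_apply crossProduct (contDiff_apply ℂ _ 0) contDiff_const) fun l J => by
      simp [scaleJet]

lemma evalJet_tangentLine (J : Jet (Fin 3)) :
    evalJet J (linearForm (J 0 ⨯₃ J 1)) = Pi.single 2 (wronskian J) :=
  evalJet_dualFrame J 2

lemma evalJet_secantLine_zero (J : Jet (Fin 3)) (w : Fin 3 → ℂ) :
    evalJet J (linearForm (J 0 ⨯₃ w)) 0 = 0 := by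
  rw [evalJet_linearForm]
  exact (dotProduct_comm _ _).trans (dot_self_cross _ _)

lemma evalJet_secantLine_one (J : Jet (Fin 3)) (w : Fin 3 → ℂ) :
    evalJet J (linearForm (J 0 ⨯₃ w)) 1 = -((J 0 ⨯₃ J 1) ⬝ᵥ w) := by
  rw [evalJet_linearForm]
  simp only [cross_apply, Matrix.vec3_dotProduct, Matrix.cons_val]
  ring

/-- The reducible conic made of the tangent line and of the line through the point in the direction
`w`. -/
def tangentPair (w : Fin 3 → ℂ) (J : Jet (Fin 3)) : MvPolynomial (Fin 3) ℂ :=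
  linearForm (J 0 ⨯₃ J 1) * linearForm (J 0 ⨯₃ w)

lemma tangentPair_mem_tangentForms (w : Fin 3 → ℂ) :
    tangentPair w ∈ tangentForms (Fin 3) 2 3 := by
  refine ⟨mul_mem_formFamilies tangentLine_mem_formFamilies (secantLine_mem_formFamilies w),
    fun J => ?_⟩
  have h := evalJet_secantLine_zero J w
  rw [tangentPair, evalJet_mul, evalJet_tangentLine]
  ext k
  fin_cases k <;> simp [jetMul_apply, h]

/-- A conic osculating the jet, in the pencil spanned by the double line through the point in the
direction `w` and the union of the tangent line with the line `e`. -/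
def osculatingConic (e w : Fin 3 → ℂ) (J : Jet (Fin 3)) : MvPolynomial (Fin 3) ℂ :=
  C (2 * ((J 0 ⨯₃ J 1) ⬝ᵥ w) ^ 2) * (linearForm (J 0 ⨯₃ J 1) * linearForm e) -
    C (wronskian J * (e ⬝ᵥ J 0)) * (linearForm (J 0 ⨯₃ w) * linearForm (J 0 ⨯₃ w))

lemma osculatingConic_mem_formFamilies (e w : Fin 3 → ℂ) :
    osculatingConic e w ∈ formFamilies (Fin 3) 2 6 := by
  have hT : ContDiff ℂ ω fun J : Jet (Fin 3) => J 0 ⨯₃ J 1 :=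
    contDiff_bilinear_apply crossProduct (contDiff_apply ℂ _ 0) (contDiff_apply ℂ _ 1)
  have h1 : (fun J : Jet (Fin 3) => C (2 * ((J 0 ⨯₃ J 1) ⬝ᵥ w) ^ 2)) ∈
      formFamilies (Fin 3) 0 4 := by
    refine scalar_mem_formFamilies ?_ fun l J => ?_
    · simp only [dotProduct]
      fun_prop
    · simp [scaleJet, cross_self]
      ring
  have h2 : (fun J : Jet (Fin 3) => C (wronskian J * (e ⬝ᵥ J 0))) ∈ formFamilies (Fin 3) 0 4 := by
    refine scalar_mem_formFamilies ?_ fun l J => ?_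
    · have h := contDiff_wronskian
      simp only [dotProduct]
      fun_prop
    · rw [wronskian_scaleJet, scaleJet_zero_apply, dotProduct_smul, smul_eq_mul]
      ring
  have hS := secantLine_mem_formFamilies w
  exact sub_mem (mul_mem_formFamilies h1 <| mul_mem_formFamilies tangentLine_mem_formFamilies <|
    const_mem_formFamilies <| linearForm_isHomogeneous e)
    (mul_mem_formFamilies h2 <| mul_mem_formFamilies hS hS)

lemma osculatingConic_mem_tangentForms (e w : Fin 3 → ℂ) :
    osculatingConic e w ∈ tangentForms (Fin 3) 2 6 := by
  refine ⟨osculatingConic_mem_formFamilies e w, fun J => ?_⟩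
  have h0 := evalJet_secantLine_zero J w
  have h1 := evalJet_secantLine_one J w
  have he : evalJet J (linearForm e) 0 = e ⬝ᵥ J 0 := by rw [evalJet_linearForm]
  rw [osculatingConic, map_sub, evalJet_C_mul, evalJet_C_mul, evalJet_mul, evalJet_mul,
    evalJet_tangentLine]
  ext k
  fin_cases k <;> simp [jetMul_apply, h0, h1, he]
  ring

/-! ### Normal forms modulo forms vanishing along a jet -/

variable {J : Jet (Fin 3)}

/-- The forms of degree `n + 1` congruent to `ℓ₀ ^ n` times a linear form, modulo the values at `J`
of the families of weight `6`. At non-degenerate jets these are all forms. -/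
def reducibleForms (n : ℕ) (J : Jet (Fin 3)) : Submodule ℂ (MvPolynomial (Fin 3) ℂ) :=
  tangentFormsAt (n + 1) 6 J ⊔
    LinearMap.range (LinearMap.mulLeft ℂ (linearForm (dualFrame J 0) ^ n) ∘ₗ linearForm)

lemma pow_mul_linearForm_mem_reducibleForms (n : ℕ) (v : Fin 3 → ℂ) :
    linearForm (dualFrame J 0) ^ n * linearForm v ∈ reducibleForms n J :=
  Submodule.mem_sup_right ⟨v, rfl⟩

lemma tangentLine_mul_secantLine_mem_tangentFormsAt {i : Fin 3} (hi : J 0 i ≠ 0)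
    (w : Fin 3 → ℂ) : linearForm (J 0 ⨯₃ J 1) * linearForm (J 0 ⨯₃ w) ∈ tangentFormsAt 2 6 J :=
  tangentFormsAt_mono hi (by norm_num)
    (Submodule.mem_map_of_mem (f := LinearMap.proj J) (tangentPair_mem_tangentForms w))

lemma secantLine_eq_neg (J : Jet (Fin 3)) :
    linearForm (J 0 ⨯₃ J 2) = -linearForm (dualFrame J 1) := by
  rw [← map_neg, ← cross_anticomm]
  rfl

lemma dualFrame_conic_mem_tangentFormsAt (hJ : wronskian J ≠ 0) :
    linearForm (dualFrame J 1) * linearForm (dualFrame J 1) -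
      (2 : ℂ) • (linearForm (dualFrame J 0) * linearForm (dualFrame J 2)) ∈
        tangentFormsAt 2 6 J := by
  have h := Submodule.mem_map_of_mem (f := LinearMap.proj J)
    (osculatingConic_mem_tangentForms (dualFrame J 0) (J 2))
  have h2 : (J 0 ⨯₃ J 1) ⬝ᵥ J 2 = wronskian J := dualFrame_dotProduct J 2 2
  have h0 : dualFrame J 0 ⬝ᵥ J 0 = wronskian J := dualFrame_dotProduct J 0 0
  have hQ : osculatingConic (dualFrame J 0) (J 2) J = (-(wronskian J ^ 2)) •
      (linearForm (dualFrame J 1) * linearForm (dualFrame J 1) -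
        (2 : ℂ) • (linearForm (dualFrame J 0) * linearForm (dualFrame J 2))) := by
    have hT : J 0 ⨯₃ J 1 = dualFrame J 2 := rfl
    rw [osculatingConic, h0, secantLine_eq_neg, hT, ← hT, h2, hT, ← smul_eq_C_mul, ← smul_eq_C_mul,
      mul_comm (linearForm (dualFrame J 2)), neg_mul_neg]
    module
  refine (Submodule.smul_mem_iff _ (neg_ne_zero.2 (pow_ne_zero 2 hJ))).1 ?_
  exact hQ ▸ h

lemma dualFrame_mul_dualFrame_mem_reducibleForms (hJ : wronskian J ≠ 0) {i : Fin 3}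
    (hi : J 0 i ≠ 0) (k r : Fin 3) :
    linearForm (dualFrame J k) * linearForm (dualFrame J r) ∈ reducibleForms 1 J := by
  have h0 (v : Fin 3 → ℂ) : linearForm (dualFrame J 0) * linearForm v ∈ reducibleForms 1 J := by
    simpa using pow_mul_linearForm_mem_reducibleForms (J := J) 1 v
  have h22 : linearForm (dualFrame J 2) * linearForm (dualFrame J 2) ∈ reducibleForms 1 J :=
    Submodule.mem_sup_left (tangentLine_mul_secantLine_mem_tangentFormsAt hi (J 1))
  have h21 : linearForm (dualFrame J 2) * linearForm (dualFrame J 1) ∈ reducibleForms 1 J := by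
    have h := tangentLine_mul_secantLine_mem_tangentFormsAt hi (J 2)
    rw [secantLine_eq_neg, mul_neg, neg_mem_iff] at h
    exact Submodule.mem_sup_left h
  have h11 : linearForm (dualFrame J 1) * linearForm (dualFrame J 1) ∈ reducibleForms 1 J := by
    have h := add_mem (Submodule.mem_sup_left (dualFrame_conic_mem_tangentFormsAt hJ))
      (Submodule.smul_mem _ (2 : ℂ) (h0 (dualFrame J 2)))
    rwa [sub_add_cancel] at h
  have h0' (v : Fin 3 → ℂ) : linearForm v * linearForm (dualFrame J 0) ∈ reducibleForms 1 J := by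
    rw [mul_comm]
    exact h0 v
  have h12 : linearForm (dualFrame J 1) * linearForm (dualFrame J 2) ∈ reducibleForms 1 J := by
    rwa [mul_comm]
  fin_cases k <;> fin_cases r
  exacts [h0 _, h0 _, h0 _, h0' _, h11, h12, h0' _, h21, h22]

lemma linearForm_mul_linearForm_mem_reducibleForms (hJ : wronskian J ≠ 0) {i : Fin 3}
    (hi : J 0 i ≠ 0) (u v : Fin 3 → ℂ) : linearForm u * linearForm v ∈ reducibleForms 1 J := by
  have h : (wronskian J * wronskian J) • (linearForm u * linearForm v) =
      ∑ k, ∑ r, ((u ⬝ᵥ J k) * (v ⬝ᵥ J r)) •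
        (linearForm (dualFrame J k) * linearForm (dualFrame J r)) := by
    rw [← smul_mul_smul_comm, ← map_smul, ← map_smul, wronskian_smul_eq_sum_dualFrame,
      wronskian_smul_eq_sum_dualFrame, map_sum, map_sum, Finset.sum_mul_sum]
    simp only [map_smul, smul_mul_smul_comm]
  refine (Submodule.smul_mem_iff _ (mul_ne_zero hJ hJ)).1 (h ▸ ?_)
  exact sum_mem fun k _ => sum_mem fun r _ => Submodule.smul_mem _ _ <|
    dualFrame_mul_dualFrame_mem_reducibleForms hJ hi k r

lemma linearForm_mul_mem_reducibleForms (hJ : wronskian J ≠ 0) {i : Fin 3} (hi : J 0 i ≠ 0)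
    (u : Fin 3 → ℂ) {n : ℕ} {F : MvPolynomial (Fin 3) ℂ} (hF : F ∈ reducibleForms n J) :
    linearForm u * F ∈ reducibleForms (n + 1) J := by
  obtain ⟨T, hT, _, ⟨v, rfl⟩, rfl⟩ := Submodule.mem_sup.1 hF
  obtain ⟨T', hT', _, ⟨v', rfl⟩, h⟩ :=
    Submodule.mem_sup.1 (linearForm_mul_linearForm_mem_reducibleForms hJ hi u v)
  simp only [LinearMap.comp_apply, LinearMap.mulLeft_apply, pow_one] at h ⊢
  have hn : (linearForm (dualFrame J 0) ^ n).IsHomogeneous n := by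
    simpa using (linearForm_isHomogeneous (dualFrame J 0)).pow n
  have hTu := mul_mem_tangentFormsAt hT (linearForm_isHomogeneous u)
  have hTn := mul_mem_tangentFormsAt hT' hn
  rw [add_comm, ← add_assoc n 1 1] at hTn
  have hsplit : linearForm u * (T + linearForm (dualFrame J 0) ^ n * linearForm v) =
      (T * linearForm u + T' * linearForm (dualFrame J 0) ^ n) +
        linearForm (dualFrame J 0) ^ (n + 1) * linearForm v' := by
    rw [mul_add, mul_left_comm, ← h]
    ring
  rw [hsplit]
  exact add_mem (Submodule.mem_sup_left (add_mem hTu hTn))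
    (pow_mul_linearForm_mem_reducibleForms (n + 1) v')

lemma homogeneousSubmodule_one_eq_range_linearForm (ι : Type) [Fintype ι] :
    homogeneousSubmodule ι ℂ 1 = LinearMap.range (linearForm (ι := ι)) := by
  rw [homogeneousSubmodule_one_eq_span_X, linearForm, Fintype.range_linearCombination]

lemma homogeneousSubmodule_le_reducibleForms (hJ : wronskian J ≠ 0) {i : Fin 3} (hi : J 0 i ≠ 0)
    (n : ℕ) : homogeneousSubmodule (Fin 3) ℂ (n + 1) ≤ reducibleForms n J := by
  induction n with
  | zero =>
    rw [zero_add, homogeneousSubmodule_one_eq_range_linearForm]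
    rintro _ ⟨v, rfl⟩
    simpa using pow_mul_linearForm_mem_reducibleForms (J := J) 0 v
  | succ n ih =>
    rw [← homogeneousSubmodule_one_pow, pow_succ', homogeneousSubmodule_one_pow, Submodule.mul_le,
      homogeneousSubmodule_one_eq_range_linearForm]
    rintro _ ⟨u, rfl⟩ F hF
    exact linearForm_mul_mem_reducibleForms hJ hi u (ih hF)

lemma evalJet_dualFrame_zero_pow (J : Jet (Fin 3)) (n : ℕ) :
    evalJet J (linearForm (dualFrame J 0) ^ n) = Pi.single 0 (wronskian J ^ n) := by
  induction n with
  | zero => simpa using evalJet_C J 1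
  | succ n ih =>
    rw [pow_succ, evalJet_mul, ih, evalJet_dualFrame, single_jetMul, ← Pi.single_smul, smul_eq_mul,
      pow_succ]

lemma eq_zero_of_evalJet_pow_mul_linearForm (hJ : wronskian J ≠ 0) {n : ℕ} {v : Fin 3 → ℂ}
    (h : evalJet J (linearForm (dualFrame J 0) ^ n * linearForm v) = 0) : v = 0 := by
  rw [evalJet_mul, evalJet_dualFrame_zero_pow, single_jetMul, evalJet_linearForm,
    smul_eq_zero_iff_right (pow_ne_zero n hJ)] at h
  refine Matrix.eq_zero_of_mulVec_eq_zero hJ (funext fun k => ?_)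
  exact (dotProduct_comm _ _).trans (congrFun h k)

lemma mem_tangentFormsAt_of_evalJet_eq_zero (hJ : wronskian J ≠ 0) {i : Fin 3} (hi : J 0 i ≠ 0)
    {d : ℕ} (hd : d ≠ 0) {F : MvPolynomial (Fin 3) ℂ} (hF : F.IsHomogeneous d)
    (h : evalJet J F = 0) : F ∈ tangentFormsAt d 6 J := by
  obtain ⟨n, rfl⟩ := Nat.exists_eq_succ_of_ne_zero hd
  obtain ⟨T, hT, _, ⟨v, rfl⟩, rfl⟩ :=
    Submodule.mem_sup.1 (homogeneousSubmodule_le_reducibleForms hJ hi n hF)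
  rw [map_add, evalJet_of_mem_tangentFormsAt hT, zero_add] at h
  have hv : v = 0 := eq_zero_of_evalJet_pow_mul_linearForm hJ h
  rwa [hv, map_zero, add_zero]

end Plane

/-! ### Generation by global sections -/

section Generation

variable {d : ℕ}

lemma exists_mulVec_eq {J : Jet (Fin 3)} (hJ : wronskian J ≠ 0) (K : Jet (Fin 3)) :
    ∃ A : Matrix (Fin 3) (Fin 3) ℂ, (fun k => A *ᵥ J k) = K := by
  have hu : IsUnit (Matrix.of J)ᵀ.det := by
    rw [Matrix.det_transpose]
    exact hJ.isUnit
  refine ⟨(Matrix.of K)ᵀ * ((Matrix.of J)ᵀ)⁻¹, ?_⟩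
  have h : (Matrix.of K)ᵀ * ((Matrix.of J)ᵀ)⁻¹ * (Matrix.of J)ᵀ = (Matrix.of K)ᵀ := by
    rw [mul_assoc, Matrix.nonsing_inv_mul _ hu, mul_one]
  ext k r
  exact congrFun (congrFun h r) k

lemma exists_formVar_add_orbitMap_eq_zero (hd : d ≠ 0) {p w : Coord d} (hp : p ∈ cone d)
    (hf : formJet p 0 ≠ 0) (hw : w ∈ coneTangent p) :
    ∃ x, (w + orbitMap p x).2.2 = 0 ∧ formVar p (w + orbitMap p x) = 0 := by
  let x : (Fin 3 → ℂ) × ℂ :=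
    (![0, -w.2.2 0 / d, -w.2.2 1 / d], -formVar p w 0 / formJet p 0)
  have hσ : (w + orbitMap p x).2.2 = 0 := by
    ext k
    fin_cases k <;> simp [x, orbitMap_apply] <;> field_simp <;> ring
  have h0 : formVar p (w + orbitMap p x) 0 = 0 := by
    simp [formVar_add, formVar_orbitMap, x, jetMul_apply_zero, hf]
  refine ⟨x, hσ, ?_⟩
  have h := mem_coneTangent_iff.1 (add_mem hw (orbitMap_mem_coneTangent hp x))
  rwa [h0, hσ, expVar_zero, smul_zero, zero_smul, add_zero] at h

lemma exists_eq_linearField_add (hd : d ≠ 0) {p v : Coord d} (hJ : wronskian p.1 ≠ 0)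
    (hσ : v.2.2 = 0) (hv : formVar p v = 0) :
    ∃ A b, v = linearField d A p + (0, b, 0) ∧ evalJet p.1 (form b) = 0 := by
  obtain ⟨A, hA⟩ := exists_mulVec_eq hJ v.1
  let b : Idx d → ℂ := v.2.1 - (linearField d A p).2.1
  have hdec : v = linearField d A p + (0, b, 0) := by
    refine Prod.ext ?_ (Prod.ext ?_ ?_)
    · simpa [linearField_apply] using hA.symm
    · simp [b]
    · simpa [linearField_apply] using hσ
  refine ⟨A, b, hdec, ?_⟩
  rw [hdec, formVar_add, formVar_linearField hd, zero_add, formVar, jetVar_zero, zero_add] at hv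
  exact hv

lemma exists_homogeneousFields_eq (hd : d ≠ 0) {k : ℕ} (hk : 6 ≤ k) (m : ℕ) {i : Fin 3} {β : Idx d}
    {p v : Coord d} (hp : p ∈ chart d i β) (hJ : wronskian p.1 ≠ 0) (hσ : v.2.2 = 0)
    (hv : formVar p v = 0) : ∃ V ∈ homogeneousFields d k m, V p = v := by
  obtain ⟨-, hi, -, -, hβ⟩ := hp
  obtain ⟨A, b, rfl, hb⟩ := exists_eq_linearField_add hd hJ hσ hv
  obtain ⟨P, hP, hPb⟩ := mem_tangentFormsAt_of_evalJet_eq_zero hJ (i := i) (by simp [hi]) hd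
    (form_isHomogeneous b) hb
  obtain ⟨n, rfl⟩ := Nat.exists_eq_add_of_le' hk
  have hform : formField β P p = (0, b, 0) := by
    have h : P p.1 = form b := hPb
    rw [formField, h, coeffs_form, hβ, one_smul]
  refine ⟨_, add_mem (monomial_smul_mem_homogeneousFields
    (linearField_mem_homogeneousFields hd A) i β (n + 6) m) (monomial_smul_mem_homogeneousFields
      (formField_mem_homogeneousFields β hP) i β n m), ?_⟩
  simp [hi, hβ, hform]

lemma exists_globalSection (hd : d ≠ 0) {k : ℕ} (hk : 6 ≤ k) (m : ℕ) {i : Fin 3} {β : Idx d}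
    {p : Coord d} (hp : p ∈ chart d i β) (hJ : wronskian p.1 ≠ 0) (hf : formJet p 0 ≠ 0)
    {w : Coord d} (hw : w ∈ tangent i β p) : ∃ s : GlobalSection d k m, s.val i β p = w := by
  obtain ⟨x, hσ, hx⟩ := exists_formVar_add_orbitMap_eq_zero hd hp.1 hf (mem_tangent_iff.1 hw).2
  obtain ⟨V, hV, hVp⟩ := exists_homogeneousFields_eq hd hk m hp hJ hσ hx
  exact ⟨.ofField hV, GlobalSection.ofField_val hV hp hw hVp⟩

end Generation

/-! ### Degenerate jets and the image of `Σ` -/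

section Sigma

lemma logDer_expJet (σ : Fin 2 → ℂ) : logDer (expJet σ) = σ := by
  ext k
  fin_cases k <;> simp [logDer, expJet]

lemma expJet_logDer {u : Fin 3 → ℂ} (hu : u 0 ≠ 0) : u 0 • expJet (logDer u) = u := by
  ext k
  fin_cases k <;> simp [logDer, expJet] <;> field_simp

variable {d : ℕ}

/-- The lift to `𝒴`, normalized by `Z₃(0) = 1`, of a jet `J` outside the curve of equation `a`. -/
def liftJet (a : Idx d → ℂ) (J : Jet (Fin 3)) : CoordY d :=
  let τ : Fin 2 → ℂ := (d : ℂ)⁻¹ • logDer (evalJet J (form a))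
  (fun k => Fin.snoc (α := fun _ => ℂ) (J k) (expJet τ k), a, -eval (J 0) (form a), τ)

lemma liftJet_castSucc (a : Idx d → ℂ) (J : Jet (Fin 3)) (k j : Fin 3) :
    (liftJet a J).1 k j.castSucc = J k j :=
  Fin.snoc_castSucc (α := fun _ => ℂ) _ _ _

lemma evalJet_liftJet_X_last (a : Idx d → ℂ) (J : Jet (Fin 3)) :
    evalJet (liftJet a J).1 (X (Fin.last 3)) = expJet (liftJet a J).2.2.2 := by
  rw [evalJet_X]
  exact funext fun k => Fin.snoc_last (n := 3) (α := fun _ => ℂ) _ (J k)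

lemma evalJet_rename_castSucc (f : MvPolynomial (Fin 3) ℂ) (J : Jet (Fin 4)) :
    evalJet J (rename Fin.castSucc f) = evalJet (fun k j => J k j.castSucc) f := by
  rw [evalJet_apply, evalJet_apply, jetD1_rename, jetD2_rename, eval_rename]
  rfl

lemma eval_liftJet_X_last (a : Idx d → ℂ) (J : Jet (Fin 3)) :
    eval ((liftJet a J).1 0) (X (Fin.last 3)) = 1 := by
  rw [← evalJet_apply_zero, evalJet_liftJet_X_last]
  rfl

lemma isLogJet_X_last_liftJet (a : Idx d → ℂ) (J : Jet (Fin 3)) :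
    IsLogJet (X (Fin.last 3)) (liftJet a J).1 (liftJet a J).2.2.2 := by
  rw [isLogJet_iff, evalJet_liftJet_X_last, eval_liftJet_X_last, one_smul]

lemma evalJet_liftJet_X_last_pow (hd : d ≠ 0) (a : Idx d → ℂ) (J : Jet (Fin 3)) :
    evalJet (liftJet a J).1 (X (Fin.last 3) ^ d) = expJet (logDer (evalJet J (form a))) := by
  have hτ : (d : ℂ) • (liftJet a J).2.2.2 = logDer (evalJet J (form a)) :=
    smul_inv_smul₀ (Nat.cast_ne_zero.2 hd) _
  rw [isLogJet_iff.1 (isLogJet_pow (isLogJet_X_last_liftJet a J) d), hτ, eval_pow,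
    eval_liftJet_X_last, one_pow, one_smul]

lemma isTangentTo_formY_liftJet (hd : d ≠ 0) {a : Idx d → ℂ} {J : Jet (Fin 3)}
    (hf : eval (J 0) (form a) ≠ 0) :
    IsTangentTo (formY a (-eval (J 0) (form a))) (liftJet a J).1 := by
  have hexp : eval (J 0) (form a) • expJet (logDer (evalJet J (form a))) = evalJet J (form a) := by
    rw [← evalJet_apply_zero] at hf ⊢
    exact expJet_logDer hf
  rw [← evalJet_eq_zero_iff, formY, map_add, evalJet_C_mul, evalJet_liftJet_X_last_pow hd,
    neg_smul, hexp, evalJet_rename_castSucc]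
  simp only [liftJet_castSucc]
  exact neg_add_cancel _

lemma liftJet_mem_coneY (hd : d ≠ 0) {a : Idx d → ℂ} (ha : a ≠ 0) {J : Jet (Fin 3)}
    (hf : eval (J 0) (form a) ≠ 0) : liftJet a J ∈ coneY d := by
  refine ⟨fun h => ?_, ha, neg_ne_zero.2 hf, isTangentTo_formY_liftJet hd hf,
    isLogJet_X_last_liftJet a J⟩
  have h0 := eval_liftJet_X_last a J
  rw [h, eval_X] at h0
  exact zero_ne_one h0

lemma piCoord_liftJet (hd : d ≠ 0) {p : Coord d} (hp : p ∈ cone d) (hf : formJet p 0 ≠ 0) :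
    piCoord (liftJet p.2.1 p.1) = p := by
  have hσ : logDer (formJet p) = p.2.2 := by
    rw [(mem_cone_iff.1 hp).2.2, ← single_jetMul, logDer_jetMul (by simpa using hf) one_ne_zero,
      logDer_single, zero_add, logDer_expJet]
  refine Prod.ext ?_ (Prod.ext rfl ?_)
  · ext k j
    exact liftJet_castSucc _ _ _ _
  · exact (smul_inv_smul₀ (Nat.cast_ne_zero.2 hd) _).trans hσ

/-- The lift to the space of logarithmic jets of `(𝒴, H)` of a jet outside the curve of equation
`a`. -/
def liftPoint (hd : d ≠ 0) {a : Idx d → ℂ} (ha : a ≠ 0)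
    (J : {J : Jet (Fin 3) // eval (J 0) (form a) ≠ 0}) : JetSpaceY d :=
  Quot.mk _ ⟨liftJet a J.1, liftJet_mem_coneY hd ha J.2⟩

lemma continuous_liftPoint (hd : d ≠ 0) {a : Idx d → ℂ} (ha : a ≠ 0) :
    Continuous (liftPoint hd ha) := by
  have hF : Continuous fun J : {J : Jet (Fin 3) // eval (J 0) (form a) ≠ 0} =>
      evalJet J.1 (form a) := (contDiff_evalJet _).continuous.comp continuous_subtype_val
  have hlog : Continuous fun J : {J : Jet (Fin 3) // eval (J 0) (form a) ≠ 0} =>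
      logDer (evalJet J.1 (form a)) := by
    refine continuous_iff_continuousAt.2 fun J => ?_
    have h : ContinuousAt logDer (evalJet J.1 (form a)) := (contDiffAt_logDer J.2).continuousAt
    exact ContinuousAt.comp (g := logDer) h hF.continuousAt
  have hτ := hlog.const_smul (d : ℂ)⁻¹
  have hexp := contDiff_expJet.continuous.comp hτ
  have hb : Continuous fun J : {J : Jet (Fin 3) // eval (J 0) (form a) ≠ 0} =>
      -eval (J.1 0) (form a) := (continuous_pi_iff.1 hF 0).neg
  have hZ : Continuous fun J : {J : Jet (Fin 3) // eval (J 0) (form a) ≠ 0} =>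
      (liftJet a J.1).1 := continuous_pi fun k =>
    Continuous.finSnoc (A := fun _ => ℂ) ((continuous_apply k).comp continuous_subtype_val)
      (continuous_pi_iff.1 hexp k)
  exact continuous_quot_mk.comp
    (.subtype_mk (hZ.prodMk (continuous_const.prodMk (hb.prodMk hτ))) _)

lemma det_affine_eq (J : Jet (Fin 3)) (h0 : J 0 0 ≠ 0) :
    let ξ := scaleJet (invJet fun k => J k 0) J
    Matrix.det !![ξ 1 1, ξ 2 1; ξ 1 2, ξ 2 2] = (J 0 0)⁻¹ ^ 3 * wronskian J := by
  intro ξ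
  have hξ : (fun k => ξ k 0) = Pi.single 0 1 := by
    rw [scaleJet_coord]
    exact jetMul_invJet h0
  have h1 : wronskian ξ = (J 0 0)⁻¹ ^ 3 * wronskian J := wronskian_scaleJet _ J
  have h (k : Fin 3) : ξ k 0 = (Pi.single 0 1 : Fin 3 → ℂ) k := congrFun hξ k
  rw [← h1, wronskian, Matrix.det_fin_three]
  simp [h, Matrix.det_fin_two, mul_comm]

lemma liftPoint_mem_sigmaZero (hd : d ≠ 0) {a : Idx d → ℂ} (ha : a ≠ 0)
    {J : {J : Jet (Fin 3) // eval (J 0) (form a) ≠ 0}} (h0 : J.1 0 0 ≠ 0)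
    (hJ : wronskian J.1 = 0) : liftPoint hd ha J ∈ sigmaZero d := by
  have hcoord (k j : Fin 3) : (liftJet a J.1).1 k j.castSucc = J.1 k j := liftJet_castSucc a J.1 k j
  have hscale (l : Fin 3 → ℂ) (k j : Fin 3) :
      scaleJet l (liftJet a J.1).1 k j.castSucc = scaleJet l J.1 k j := by
    fin_cases k <;> simp [scaleJet, hcoord]
  have h1 : (fun k => (liftJet a J.1).1 k 0) = fun k => J.1 k 0 := funext fun k => hcoord k 0
  have h := det_affine_eq J.1 h0
  rw [hJ, mul_zero] at h
  refine ⟨_, rfl, (hcoord 0 0).trans_ne h0, ?_⟩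
  simp only [← hscale, ← h1] at h
  exact h

lemma mem_closure_of_wronskian_eq_zero {J : Jet (Fin 3)} (h0 : J 0 ≠ 0) (hJ : wronskian J = 0) :
    J ∈ closure {K : Jet (Fin 3) | K 0 0 ≠ 0 ∧ wronskian K = 0} := by
  by_cases h : J 0 0 = 0
  swap
  · exact subset_closure ⟨h, hJ⟩
  obtain ⟨r, hr⟩ := Function.ne_iff.1 h0
  have hr0 : r ≠ 0 := by
    rintro rfl
    exact hr h
  let shear (t : ℂ) : Jet (Fin 3) := Matrix.of J * Matrix.transvection r 0 t
  have hcont : Continuous shear := by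
    have h : Continuous (Matrix.single (α := ℂ) r (0 : Fin 3)) := by
      refine continuous_matrix fun i j => ?_
      simp only [Matrix.single_apply]
      split_ifs
      exacts [continuous_id, continuous_const]
    exact continuous_const.matrix_mul (continuous_const.add h)
  have hshear : Filter.Tendsto shear (𝓝[≠] 0) (𝓝 J) := by
    have h := hcont.tendsto 0
    simp only [shear, Matrix.transvection_zero, mul_one] at h
    exact h.mono_left nhdsWithin_le_nhds
  refine mem_closure_of_tendsto hshear (eventually_mem_nhdsWithin.mono fun t ht => ⟨?_, ?_⟩)
  · have h1 : shear t 0 0 = J 0 0 + t * J 0 r := Matrix.mul_transvection_apply_same ..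
    rw [h1, h, zero_add]
    exact mul_ne_zero ht hr
  · have h1 : wronskian (shear t) = (Matrix.of J * Matrix.transvection r 0 t).det := rfl
    rw [h1, Matrix.det_mul, Matrix.det_transvection_of_ne _ _ hr0, mul_one]
    exact hJ

lemma mem_image_sigma [NeZero d] {p : Coord d} (hp : p ∈ cone d) (hf : formJet p 0 ≠ 0)
    (hJ : wronskian p.1 = 0) : (Quot.mk _ ⟨p, hp⟩ : JetSpace d) ∈ piTwo d '' sigma d := by
  have hd := NeZero.ne d
  let U : Set (Jet (Fin 3)) := {J | eval (J 0) (form p.2.1) ≠ 0}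
  have hU : IsOpen U := by
    have h := (contDiff_evalJet (form p.2.1)).continuous
    exact isOpen_ne_fun ((continuous_apply 0).comp h) continuous_const
  let J₀ : U := ⟨p.1, hf⟩
  have hJ₀ : J₀ ∈ closure (Subtype.val ⁻¹' {K : Jet (Fin 3) | K 0 0 ≠ 0 ∧ wronskian K = 0}) := by
    rw [← hU.isOpenMap_subtype_val.preimage_closure_eq_closure_preimage continuous_subtype_val]
    exact mem_closure_of_wronskian_eq_zero hp.1 hJ
  refine ⟨liftPoint hd hp.2.1 J₀, map_mem_closure (continuous_liftPoint hd hp.2.1) hJ₀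
    fun K hK => liftPoint_mem_sigmaZero hd hp.2.1 hK.1 hK.2, ?_⟩
  exact congrArg (Quot.mk _) (Subtype.ext (piCoord_liftJet hd hp hf))

lemma mem_universalCurve_of_formJet_eq_zero (p : cone d) (hf : formJet p.1 0 = 0) :
    proj d (Quot.mk _ p) ∈ universalCurve d :=
  ⟨p.1.1 0, p.2.1, p.1.2.1, p.2.2.1, hf, rfl⟩

end Sigma

end

end LogJet

theorem mainTheorem4_general (d : ℕ) [NeZero d] {k : ℕ} (hk : 6 ≤ k) (m : ℕ)
    (x : LogJet.JetSpace d)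
    (hx : x ∉ LogJet.piTwo d '' LogJet.sigma d ∪ LogJet.proj d ⁻¹' LogJet.universalCurve d) :
    LogJet.IsGeneratedAt d k m x := by
  rintro i β p rfl hchart w hw
  rw [Set.mem_union, not_or] at hx
  have hcurve : LogJet.formJet p.1 0 ≠ 0 := fun h =>
    hx.2 (LogJet.mem_universalCurve_of_formJet_eq_zero p h)
  have hwronskian : LogJet.wronskian p.1.1 ≠ 0 := fun h =>
    hx.1 (LogJet.mem_image_sigma p.2 hcurve h)
  exact LogJet.exists_globalSection (NeZero.ne d) hk m hchart hwronskian hcurve hw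

theorem mainTheorem4 (d : ℕ) [NeZero d] :
    ∃ m₀ : ℕ, ∀ m : ℕ, m₀ ≤ m → ∀ x : LogJet.JetSpace d,
      x ∉ LogJet.piTwo d '' LogJet.sigma d ∪ LogJet.proj d ⁻¹' LogJet.universalCurve d →
        LogJet.IsGeneratedAt d 7 m x :=
  ⟨0, fun m _ x hx => mainTheorem4_general d (by norm_num) m x hx⟩
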